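/- For a topological space $Y$ let $\pi_0^{top}(Y)$ be the set of path components of $Y$ with the quotient topology with respect to the canonical map $P_Y:Y\to\pi_0(Y)$. For a based space $(Y,y)$ let $\Omega(Y,y)$ be the space of loops at $y$ with the compact-open topology, and let $\pi_1^{top}(Y,y)=\pi_0^{top}(\Omega(Y,y))$, which is the fundamental group endowed with the quotient topology from $\Omega(Y,y)$. For a space $Y$ let $F_R(Y)$ be the free group on the set $Y$ with the quotient topology with respect to the reduction of words $R:\coprod_{n\ge 0}(Y\sqcup Y^{-1})^n\to F(Y)$, where $Y^{-1}$ is a homeomorphic copy of $Y$. Both $\pi_1^{top}(Y,y)$ and $F_R(Y)$ are quasitopological groups, i.e. groups with a topology in which inversion is continuous and multiplication is continuous in each variable. For a space $X$ let $X_+=X\sqcup\{*\}$, let $\Sigma(X_+)=(X_+\times[0,1])/(X\times\{0,1\}\cup\{*\}\times[0,1])$ be its reduced suspension, with its canonical basepoint, and for $x\in X$ let $u_x$ be the loop in $\Sigma(X_+)$ sending $t$ to the image of $(x,t)$. Let $X$ be a Hausdorff space. Consider the two conditions (i) the assignment $[u_x]\mapsto P_X(x)$, $x\in X$, extends to an isomorphism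 of quasitopological groups (a group isomorphism that is a homeomorphism) $\pi_1^{top}(\Sigma(X_+))\cong F_R(\pi_0^{top}(X))$; (ii) the power $(P_X)^n:X^n\to\pi_0^{top}(X)^n$ is a quotient map for every $n\ge 1$. Then (ii) implies (i); and if moreover $\pi_0^{top}(X)$ is Hausdorff, then (i) holds if and only if (ii) holds. -/

import Mathlib

open Topology

namespace TopFund

/-! ### Quasitopological groups -/

/-- A quasitopological group: a group with a topology such that inversion is continuous and
multiplication is continuous in each variable separately. -/
class IsQuasitopologicalGroup (G : Type*) [TopologicalSpace G] [Group G] : Prop extends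
  SeparatelyContinuousMul G, ContinuousInv G

/-! ### The topological fundamental group

The path component space of `Y` is Mathlib's `ZerothHomotopy Y`, which carries the quotient topology
with respect to `ZerothHomotopy.mk : Y → ZerothHomotopy Y`.  The loop space is `Path x x` with the
compact-open topology. -/

theorem joined_of_homotopic {Y : Type*} [TopologicalSpace Y] {x y : Y} {p q : Path x y}
    (h : p.Homotopic q) : Joined p q := by
  obtain ⟨F⟩ := h
  refine ⟨⟨⟨F.eval, ?_⟩, F.eval_zero, F.eval_one⟩⟩
  rw [← Path.continuous_uncurry_iff]
  exact F.continuous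

/-- The underlying type of the topological fundamental group: the path component space of the
loop space, with its quotient topology. -/
abbrev PiOneTop (Y : Type*) [TopologicalSpace Y] (x : Y) : Type _ := ZerothHomotopy (Path x x)

/-- Path components of the loop space are the same as homotopy classes of loops. -/
theorem mk_eq_mk_iff_homotopic {Y : Type*} [TopologicalSpace Y] {x : Y} (p q : Path x x) :
    (ZerothHomotopy.mk p : PiOneTop Y x) = ZerothHomotopy.mk q ↔ p.Homotopic q := by
  constructor
  · intro h
    obtain ⟨γ⟩ : Joined p q := Quotient.exact h
    refine ⟨⟨⟨⟨fun st => γ st.1 st.2, ?_⟩, ?_, ?_⟩, ?_⟩⟩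
    · exact Path.continuous_uncurry_iff.mpr γ.continuous
    · intro t; simp
    · intro t; simp
    · intro t s hs
      rcases hs with rfl | rfl <;> simp
  · intro h
    exact Quotient.sound (joined_of_homotopic h)

/-- The fundamental group structure: multiplication is `[p] * [q] = [p ∗ q]` (first `p`, then `q`),
the identity is the class of the constant loop, and `[p]⁻¹` is the class of the reversed loop. -/
noncomputable instance PiOneTop.instGroup {Y : Type*} [TopologicalSpace Y] (x : Y) : Group (PiOneTop Y x) where
  mul := Quotient.map₂ (fun p q => p.trans q) (by
    rintro p p' hp q q' hq
    have h1 : Joined (p.trans q) (p'.trans q) :=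
      hp.map (f := fun r : Path x x => r.trans q)
        (Path.continuous_trans.comp (continuous_id.prodMk continuous_const))
    have h2 : Joined (p'.trans q) (p'.trans q') :=
      hq.map (f := fun r : Path x x => p'.trans r)
        (Path.continuous_trans.comp (continuous_const.prodMk continuous_id))
    exact h1.trans h2)
  one := ZerothHomotopy.mk (Path.refl x)
  inv := Quotient.map (fun p => p.symm) (by
    rintro p p' hp
    exact hp.map (f := fun r : Path x x => r.symm) Path.continuous_symm)
  mul_assoc := by
    rintro ⟨p⟩ ⟨q⟩ ⟨r⟩
    exact Quotient.sound (joined_of_homotopic ⟨Path.Homotopy.transAssoc p q r⟩)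
  one_mul := by
    rintro ⟨p⟩
    exact Quotient.sound (joined_of_homotopic ⟨Path.Homotopy.reflTrans p⟩)
  mul_one := by
    rintro ⟨p⟩
    exact Quotient.sound (joined_of_homotopic ⟨Path.Homotopy.transRefl p⟩)
  inv_mul_cancel := by
    rintro ⟨p⟩
    exact Quotient.sound (joined_of_homotopic ⟨(Path.Homotopy.reflSymmTrans p).symm⟩)

theorem PiOneTop.mk_mul_mk {Y : Type*} [TopologicalSpace Y] {x : Y} (p q : Path x x) :
    (ZerothHomotopy.mk p * ZerothHomotopy.mk q : PiOneTop Y x) = ZerothHomotopy.mk (p.trans q) :=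
  rfl

instance PiOneTop.instIsQuasitopologicalGroup {Y : Type*} [TopologicalSpace Y] (x : Y) :
    IsQuasitopologicalGroup (PiOneTop Y x) where
  continuous_const_mul := by
    rintro ⟨p⟩
    refine ZerothHomotopy.isQuotientMap_mk.continuous_iff.mpr ?_
    exact ZerothHomotopy.isQuotientMap_mk.continuous.comp
      (Path.continuous_trans.comp (continuous_const.prodMk continuous_id) :
        Continuous fun r : Path x x => p.trans r)
  continuous_mul_const := by
    rintro ⟨p⟩
    refine ZerothHomotopy.isQuotientMap_mk.continuous_iff.mpr ?_
    exact ZerothHomotopy.isQuotientMap_mk.continuous.comp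
      (Path.continuous_trans.comp (continuous_id.prodMk continuous_const) :
        Continuous fun r : Path x x => r.trans p)
  continuous_inv := by
    refine ZerothHomotopy.isQuotientMap_mk.continuous_iff.mpr ?_
    exact ZerothHomotopy.isQuotientMap_mk.continuous.comp
      (Path.continuous_symm : Continuous fun r : Path x x => r.symm)

/-! ### The reduced suspension of `X₊` -/

/-- The subset `X × {0, 1} ∪ {∗} × I` of `X₊ × I`, where `X₊ = X ⊔ {∗}`. -/
def suspCollapse (X : Type*) : Set ((X ⊕ Unit) × unitInterval) :=
  {p | (∃ s, p.1 = Sum.inr s) ∨ p.2 = 0 ∨ p.2 = 1}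

/-- The equivalence relation on `X₊ × I` that collapses `X × {0, 1} ∪ {∗} × I` to a point. -/
def suspSetoid (X : Type*) : Setoid ((X ⊕ Unit) × unitInterval) where
  r p q := p = q ∨ (p ∈ suspCollapse X ∧ q ∈ suspCollapse X)
  iseqv :=
    { refl := fun _ => Or.inl rfl
      symm := by
        rintro p q (h | ⟨h1, h2⟩)
        · exact Or.inl h.symm
        · exact Or.inr ⟨h2, h1⟩
      trans := by
        rintro p q r (rfl | ⟨h1, h2⟩) (rfl | ⟨h3, h4⟩)
        · exact Or.inl rfl
        · exact Or.inr ⟨h3, h4⟩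
        · exact Or.inr ⟨h1, h2⟩
        · exact Or.inr ⟨h1, h4⟩ }

/-- The reduced suspension `Σ(X₊) = (X₊ × I) / (X × {0, 1} ∪ {∗} × I)`. -/
def Susp (X : Type*) : Type _ := Quotient (suspSetoid X)

/-- `Σ(X₊)` has the quotient topology. -/
instance Susp.instTopologicalSpace (X : Type*) [TopologicalSpace X] : TopologicalSpace (Susp X) :=
  inferInstanceAs (TopologicalSpace (Quotient (suspSetoid X)))

/-- The quotient map `X₊ × I → Σ(X₊)`. -/
def Susp.proj {X : Type*} (p : (X ⊕ Unit) × unitInterval) : Susp X := Quotient.mk (suspSetoid X) p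

/-- The canonical basepoint of `Σ(X₊)`. -/
def Susp.base (X : Type*) : Susp X := Susp.proj (Sum.inr (), 0)

/-- The loop `u_x : t ↦ x ∧ t` in `Σ(X₊)`, where `x ∧ t` is the image of `(x, t)`. -/
def Susp.loop {X : Type*} [TopologicalSpace X] (x : X) : Path (Susp.base X) (Susp.base X) where
  toFun t := Susp.proj (Sum.inl x, t)
  continuous_toFun :=
    (continuous_quotient_mk' : Continuous (Quotient.mk (suspSetoid X))).comp
      (continuous_const.prodMk continuous_id)
  source' := Quotient.sound (Or.inr ⟨Or.inr (Or.inl rfl), Or.inl ⟨(), rfl⟩⟩)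
  target' := Quotient.sound (Or.inr ⟨Or.inr (Or.inr rfl), Or.inl ⟨(), rfl⟩⟩)

/-! ### The free group with the reduction topology -/

/-- The free topological monoid `∐ₙ (Y ⊔ Y⁻¹)ⁿ` of unreduced words: `Sum.inl y` is the letter `y`
and `Sum.inr y` is the letter `y⁻¹`. -/
abbrev Words (Y : Type*) : Type _ := Σ n : ℕ, (Fin n → Y ⊕ Y)

/-- The free group `F(Y)`, to be endowed with the reduction topology. -/
def FR (Y : Type*) : Type _ := FreeGroup Y

instance FR.instGroup (Y : Type*) : Group (FR Y) := inferInstanceAs (Group (FreeGroup Y))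

/-- The canonical injection of generators. -/
def FR.of {Y : Type*} (y : Y) : FR Y := (FreeGroup.of y : FreeGroup Y)

/-- The element of `F(Y)` represented by a letter of `Y ⊔ Y⁻¹`. -/
def FR.letter {Y : Type*} : Y ⊕ Y → FR Y := Sum.elim (fun y => FR.of y) (fun y => (FR.of y)⁻¹)

/-- The reduction map `R` from unreduced words to the free group. -/
def FR.reduction {Y : Type*} (w : Words Y) : FR Y := (List.ofFn fun i => FR.letter (w.2 i)).prod

/-- The reduction topology: the quotient topology with respect to the reduction map. -/
instance FR.instTopologicalSpace (Y : Type*) [TopologicalSpace Y] : TopologicalSpace (FR Y) :=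
  TopologicalSpace.coinduced FR.reduction inferInstance

/-- The concatenation of words. -/
def Words.append {Y : Type*} (v w : Words Y) : Words Y := ⟨v.1 + w.1, Fin.append v.2 w.2⟩

/-- The involution of words. -/
def Words.inv {Y : Type*} (w : Words Y) : Words Y := ⟨w.1, fun i => (w.2 i.rev).swap⟩

theorem FR.reduction_append {Y : Type*} (v w : Words Y) :
    FR.reduction (v.append w) = FR.reduction v * FR.reduction w := by
  obtain ⟨m, v⟩ := v
  obtain ⟨n, w⟩ := w
  have : (fun i => FR.letter (Fin.append v w i)) =
      Fin.append (fun i => FR.letter (v i)) (fun i => FR.letter (w i)) := by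
    funext i
    refine Fin.addCases (fun j => ?_) (fun j => ?_) i <;> simp
  simp only [FR.reduction, Words.append, this, List.ofFn_fin_append, List.prod_append]

theorem FR.letter_swap {Y : Type*} (a : Y ⊕ Y) : FR.letter a.swap = (FR.letter a)⁻¹ := by
  cases a <;> simp [FR.letter]

theorem FR.reduction_inv {Y : Type*} (w : Words Y) :
    FR.reduction w.inv = (FR.reduction w)⁻¹ := by
  obtain ⟨n, w⟩ := w
  simp only [FR.reduction, Words.inv, FR.letter_swap, List.prod_inv_reverse]
  congr 1
  apply List.ext_getElem
  · simp
  · intro i h1 h2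
    simp only [List.length_ofFn] at h1
    simp only [List.getElem_ofFn, List.getElem_reverse, List.getElem_map, List.length_map,
      List.length_ofFn]
    congr 3
    ext
    simp [Fin.rev]
    omega

theorem FR.reduction_surjective {Y : Type*} : Function.Surjective (FR.reduction (Y := Y)) := by
  intro g
  refine FreeGroup.induction_on (C := fun g : FreeGroup Y => ∃ w : Words Y, FR.reduction w = g)
    g ?_ ?_ ?_ ?_
  · exact ⟨⟨0, Fin.elim0⟩, by simp only [FR.reduction, List.ofFn_zero, List.prod_nil]; rfl⟩
  · intro y
    exact ⟨⟨1, fun _ => Sum.inl y⟩, by simp [FR.reduction, FR.letter]; rfl⟩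
  · rintro y ⟨w, hw⟩
    exact ⟨w.inv, by rw [FR.reduction_inv, hw]; rfl⟩
  · rintro g h ⟨v, hv⟩ ⟨w, hw⟩
    exact ⟨v.append w, by rw [FR.reduction_append, hv, hw]; rfl⟩

theorem FR.isQuotientMap_reduction {Y : Type*} [TopologicalSpace Y] :
    IsQuotientMap (FR.reduction (Y := Y)) :=
  ⟨⟨rfl⟩, FR.reduction_surjective⟩

instance FR.instIsQuasitopologicalGroup (Y : Type*) [TopologicalSpace Y] :
    IsQuasitopologicalGroup (FR Y) where
  continuous_const_mul := by
    intro a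
    obtain ⟨v, rfl⟩ := FR.reduction_surjective a
    refine FR.isQuotientMap_reduction.continuous_iff.mpr ?_
    have h : (fun b => FR.reduction v * b) ∘ FR.reduction = FR.reduction ∘ v.append :=
      funext fun w => (FR.reduction_append v w).symm
    rw [h]
    refine FR.isQuotientMap_reduction.continuous.comp (continuous_sigma fun n => ?_)
    have hc : Continuous fun w : Fin n → Y ⊕ Y => Fin.append v.2 w := by
      refine continuous_pi fun i => ?_
      refine Fin.addCases (fun j => ?_) (fun j => ?_) i
      · simpa using continuous_const
      · simpa using continuous_apply j
    exact (continuous_sigmaMk (σ := fun m => Fin m → Y ⊕ Y) (i := v.1 + n)).comp hc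
  continuous_mul_const := by
    intro a
    obtain ⟨v, rfl⟩ := FR.reduction_surjective a
    refine FR.isQuotientMap_reduction.continuous_iff.mpr ?_
    have h : (fun b => b * FR.reduction v) ∘ FR.reduction = FR.reduction ∘ fun w => w.append v :=
      funext fun w => (FR.reduction_append w v).symm
    rw [h]
    refine FR.isQuotientMap_reduction.continuous.comp (continuous_sigma fun n => ?_)
    have hc : Continuous fun w : Fin n → Y ⊕ Y => Fin.append w v.2 := by
      refine continuous_pi fun i => ?_
      refine Fin.addCases (fun j => ?_) (fun j => ?_) i
      · simpa using continuous_apply j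
      · simpa using continuous_const
    exact (continuous_sigmaMk (σ := fun m => Fin m → Y ⊕ Y) (i := n + v.1)).comp hc
  continuous_inv := by
    refine FR.isQuotientMap_reduction.continuous_iff.mpr ?_
    have h : (fun b : FR Y => b⁻¹) ∘ FR.reduction = FR.reduction ∘ Words.inv :=
      funext fun w => (FR.reduction_inv w).symm
    rw [h]
    refine FR.isQuotientMap_reduction.continuous.comp (continuous_sigma fun n => ?_)
    have hc : Continuous fun (w : Fin n → Y ⊕ Y) (i : Fin n) => (w i.rev).swap :=
      continuous_pi fun i => continuous_sum_swap.comp (continuous_apply i.rev)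
    exact (continuous_sigmaMk (σ := fun m => Fin m → Y ⊕ Y) (i := n)).comp hc

/-! ### Canonical isomorphism and powers of the path component map -/

/-- The canonical isomorphism of groups between `π₁(Σ(X₊))` and `F(π₀(X))`, under which the class of
the loop `u_x` corresponds to the generator given by the path component of `x`, is an isomorphism of
quasitopological groups from `π₁ᵗᵒᵖ(Σ(X₊))` to `F_R(π₀ᵗᵒᵖ(X))`. -/
def CanonicalIso (X : Type*) [TopologicalSpace X] : Prop :=
  ∃ e : PiOneTop (Susp X) (Susp.base X) ≃ₜ* FR (ZerothHomotopy X),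
    ∀ x : X, e (ZerothHomotopy.mk (Susp.loop x)) = FR.of (ZerothHomotopy.mk x)

/-- The power `(P_X)ⁿ : Xⁿ → π₀ᵗᵒᵖ(X)ⁿ` of the path component quotient map. -/
def powP (X : Type*) [TopologicalSpace X] (n : ℕ) : (Fin n → X) → (Fin n → ZerothHomotopy X) :=
  fun x i => ZerothHomotopy.mk (x i)

end TopFund

/-!
Let `Y = Σ(X₊)`, let `P : X → π₀(X)` be the quotient map, and call elements of
`Words X = ∐ₙ (X ⊔ X⁻¹)ⁿ` words. Everything rests on comparing loops in `Y` with words in `X`.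

The suspension is covered by two open sets: `Susp.outer`, the two outer thirds of all arcs, which
contracts to the basepoint, and `Susp.inner`, the complement of the basepoint, a copy of
`X × (0, 1)`.
Given a group `H` and a function `f : X → H`, gluing trivial `H`-bundles over the two pieces along
the function that is `f x` on the upper part of the arc of `x` and `1` on the lower part gives a
notion of lift of a path to `H` (`IsLift`). The components of `X` need not be open, so this is not a
covering space; but paths only see path components, and if `f` is constant on them, lifts exist and
their endpoints are unique (`exists_isLift`, `IsLift.apply_one_eq`). Two cases matter: for
`H = F(π₀(X))` and `f x = P x` the endpoint of the lift is the holonomy of the loop, and for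
`H = π₁(Y)` and `f x = [u_x]` it is the homotopy class of the loop (`exists_isLift_loopClass`).

The main point is that the endpoint of a lift is computed locally by a word that varies continuously
with the loop and does not depend on `H` (`hasOuterWord_one`, `exists_local_word`): subdivide the
time interval so that each part is mapped into one of the two pieces; nearby loops do the same, and
the word records the points of `X` over which the loop passes at the times where the pieces
change. This has three consequences.

* The holonomy is constant along paths of loops, hence a homomorphism on `π₁(Y)`, and it is inverse
  to the homomorphism `F(π₀(X)) → π₁(Y)`, `P x ↦ [u_x]` (`holonomyEquiv`).
* The map `Words X → π₁ᵗᵒᵖ(Y)` is a quotient map, because loops locally lift to words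
  (`isQuotientMap_wordEval_loopClass`).
* Hence the isomorphism is a homeomorphism if and only if the composite
  `Words X → Words π₀(X) → F_R(π₀(X))` is a quotient map (`canonicalIso_iff`).

If all powers of `P` are quotient maps then so is `Words X → Words π₀(X)`, since words with
prescribed signs form open sets (`isQuotientMap_map`). Conversely, let `π₀(X)` be Hausdorff and let
`C ⊆ π₀(X)ⁿ` have closed preimage in `Xⁿ`. Regard the elements of `C` as positive words. A word
reduces to an element of `C` if and only if it is one or it contains a cancelling pair whose
deletion leaves such a word; cancellation is a closed condition, so by induction on the length the words in
`X` that reduce to `C` form a closed set (`isClosed_reduction_mem`). So the image of `C` in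
`F_R(π₀(X))` is closed, and so is `C` (`isQuotientMap_pow`).
-/

namespace TopFund

/-! ### Words and their values in a group -/

/-- The value of the word `w` in a group `H` when the letters are interpreted by `f`. -/
def wordEval {Z : Type*} {H : Type*} [Group H] (f : Z → H) (w : Words Z) : H :=
  (List.ofFn fun i => Sum.elim f (fun x => (f x)⁻¹) (w.2 i)).prod

theorem map_wordEval {Z H K : Type*} [Group H] [Group K] (φ : H →* K) (f : Z → H) (w : Words Z) :
    φ (wordEval f w) = wordEval (fun z => φ (f z)) w := by
  simp only [wordEval, map_list_prod, List.map_ofFn]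
  congr 2
  funext i
  rcases h : w.2 i with a | a <;> simp [h]

/-- Letterwise application of a map to words. -/
def Words.map {Z Y : Type*} (q : Z → Y) (w : Words Z) : Words Y :=
  ⟨w.1, fun i => Sum.map q q (w.2 i)⟩

theorem wordEval_comp {Z Y H : Type*} [Group H] (q : Z → Y) (f : Y → H) (w : Words Z) :
    wordEval (fun z => f (q z)) w = wordEval f (w.map q) := by
  simp only [wordEval, Words.map]
  congr 2
  funext i
  rcases h : w.2 i with a | a <;> simp

theorem wordEval_eq_lift {Z H : Type*} [Group H] (f : Z → H) (w : Words Z) :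
    wordEval f w = FreeGroup.lift f (FR.reduction w) := by
  have h := map_wordEval (FreeGroup.lift f) FreeGroup.of w
  simp only [FreeGroup.lift_apply_of] at h
  exact h.symm

theorem wordEval_append {Z H : Type*} [Group H] (f : Z → H) (v w : Words Z) :
    wordEval f (v.append w) = wordEval f v * wordEval f w := by
  rw [wordEval_eq_lift, FR.reduction_append, wordEval_eq_lift, wordEval_eq_lift]
  exact map_mul (FreeGroup.lift f) _ _

theorem wordEval_inv {Z H : Type*} [Group H] (f : Z → H) (w : Words Z) :
    wordEval f w.inv = (wordEval f w)⁻¹ := by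
  rw [wordEval_eq_lift, FR.reduction_inv, wordEval_eq_lift]
  exact map_inv (FreeGroup.lift f) _

/-- The empty word. -/
def Words.nil (Z : Type*) : Words Z := ⟨0, Fin.elim0⟩

/-- The word with the single positive letter `z`. -/
def Words.single {Z : Type*} (z : Z) : Words Z := ⟨1, fun _ => Sum.inl z⟩

theorem wordEval_nil {Z H : Type*} [Group H] (f : Z → H) : wordEval f (Words.nil Z) = 1 := by
  simp [wordEval, Words.nil]

theorem wordEval_single {Z H : Type*} [Group H] (f : Z → H) (z : Z) :
    wordEval f (Words.single z) = f z := by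
  simp [wordEval, Words.single]

theorem Words.continuous_single {Z : Type*} [TopologicalSpace Z] :
    Continuous (Words.single : Z → Words Z) :=
  (continuous_sigmaMk (σ := fun m => Fin m → Z ⊕ Z) (i := 1)).comp
    (continuous_pi fun _ => continuous_inl)

theorem Words.continuous_append {Z : Type*} [TopologicalSpace Z] :
    Continuous fun p : Words Z × Words Z => p.1.append p.2 := by
  rw [continuous_iff_continuousAt]
  rintro ⟨⟨m, v⟩, ⟨n, w⟩⟩
  have ho : IsOpenEmbedding (Prod.map (Sigma.mk (β := fun m => Fin m → Z ⊕ Z) m)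
      (Sigma.mk (β := fun m => Fin m → Z ⊕ Z) n)) :=
    IsOpenEmbedding.prodMap IsOpenEmbedding.sigmaMk IsOpenEmbedding.sigmaMk
  refine (ho.continuousAt_iff (x := (v, w))).mp ?_
  have hc : Continuous fun p : (Fin m → Z ⊕ Z) × (Fin n → Z ⊕ Z) => Fin.append p.1 p.2 := by
    refine continuous_pi fun i => ?_
    refine Fin.addCases (fun j => ?_) (fun j => ?_) i
    · simp only [Fin.append_left]; fun_prop
    · simp only [Fin.append_right]; fun_prop
  exact ((continuous_sigmaMk (σ := fun m => Fin m → Z ⊕ Z) (i := m + n)).comp hc).continuousAt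

theorem Words.continuous_inv {Z : Type*} [TopologicalSpace Z] :
    Continuous (Words.inv : Words Z → Words Z) := by
  refine continuous_sigma fun n => ?_
  have hc : Continuous fun (w : Fin n → Z ⊕ Z) (i : Fin n) => (w i.rev).swap :=
    continuous_pi fun i => continuous_sum_swap.comp (continuous_apply i.rev)
  exact (continuous_sigmaMk (σ := fun m => Fin m → Z ⊕ Z) (i := n)).comp hc

theorem Words.continuous_map {Z Y : Type*} [TopologicalSpace Z] [TopologicalSpace Y] {q : Z → Y}
    (hq : Continuous q) : Continuous (Words.map q) := by
  refine continuous_sigma fun n => ?_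
  have hc : Continuous fun (w : Fin n → Z ⊕ Z) (i : Fin n) => Sum.map q q (w i) :=
    continuous_pi fun i => (hq.sumMap hq).comp (continuous_apply i)
  exact (continuous_sigmaMk (σ := fun m => Fin m → Y ⊕ Y) (i := n)).comp hc

theorem Joined.eq_of_discreteTopology {D : Type*} [TopologicalSpace D] [DiscreteTopology D]
    {a b : D} (h : Joined a b) : a = b := by
  obtain ⟨γ⟩ := h
  have := PreconnectedSpace.constant (inferInstance : PreconnectedSpace unitInterval) γ.continuous
    (x := 0) (y := 1)
  simpa using this

/-- A function on letters which is constant on path components extends to a function on words which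
is constant on path components. -/
theorem wordEval_eq_of_joined {Z H : Type*} [TopologicalSpace Z] [Group H] {f : Z → H}
    (hf : ∀ x y, Joined x y → f x = f y) {v w : Words Z} (h : Joined v w) :
    wordEval f v = wordEval f w := by
  obtain ⟨γ⟩ := h
  obtain ⟨n, δ, hδ⟩ := ContinuousMap.exists_lift_sigma γ.toContinuousMap
  have h0 : v = ⟨n, δ 0⟩ := by
    rw [← γ.source]; exact congrArg (fun k => k 0) hδ
  have h1 : w = ⟨n, δ 1⟩ := by
    rw [← γ.target]; exact congrArg (fun k => k 1) hδ
  subst h0 h1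
  simp only [wordEval]
  congr 2
  funext i
  have hj : Joined (δ 0 i) (δ 1 i) :=
    ⟨⟨⟨fun t => δ t i, by fun_prop⟩, rfl, rfl⟩⟩
  -- The sign of the letter and its underlying point of `Z` both move along a path.
  have hs : (δ 0 i).isLeft = (δ 1 i).isLeft :=
    Joined.eq_of_discreteTopology (hj.map (f := Sum.isLeft)
      (continuous_sum_dom.mpr ⟨continuous_const, continuous_const⟩))
  have hx : Joined ((δ 0 i).elim id id) ((δ 1 i).elim id id) :=
    hj.map (continuous_sum_dom.mpr ⟨continuous_id, continuous_id⟩)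
  rcases h0 : δ 0 i with a | a <;> rcases h1 : δ 1 i with b | b <;> simp_all <;>
    exact hf _ _ hx

open scoped unitInterval

universe u

/-! ### The two open pieces of the suspension -/

namespace Susp

variable {X : Type*} [TopologicalSpace X]

theorem isQuotientMap_proj : IsQuotientMap (proj : (X ⊕ Unit) × I → Susp X) :=
  isQuotientMap_quotient_mk'

theorem proj_surjective {X : Type*} : Function.Surjective (proj : (X ⊕ Unit) × I → Susp X) :=
  Quotient.mk_surjective

theorem proj_eq_base {X : Type*} {p : (X ⊕ Unit) × I} (hp : p ∈ suspCollapse X) : proj p = base X :=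
  Quotient.sound (Or.inr ⟨hp, Or.inl ⟨(), rfl⟩⟩)

/-- The height of a point of the suspension: its distance to the nearer end of its arc, and `0` at
the basepoint. -/
noncomputable def height : Susp X → ℝ :=
  Quotient.lift (fun p => min (p.2 : ℝ) (1 - p.2) * Sum.elim (fun _ => 1) (fun _ => 0) p.1) (by
    have key : ∀ p ∈ suspCollapse X,
        min (p.2 : ℝ) (1 - p.2) * Sum.elim (fun _ => 1) (fun _ => 0) p.1 = 0 := by
      rintro ⟨a, t⟩ (⟨s, rfl⟩ | h | h)
      · simp
      · simp only at h; simp [h]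
      · simp only at h; simp [h]
    rintro p q (rfl | ⟨h1, h2⟩)
    · rfl
    · exact (key p h1).trans (key q h2).symm)

theorem height_inl {X : Type*} (x : X) (t : I) :
    height (proj (Sum.inl x, t)) = min (t : ℝ) (1 - t) := by
  change min (t : ℝ) (1 - t) * Sum.elim (fun _ => 1) (fun _ => 0) (Sum.inl x : X ⊕ Unit) = _
  simp

theorem height_base {X : Type*} : height (base X) = 0 := by
  change min _ _ * Sum.elim (fun _ => 1) (fun _ => 0) (Sum.inr () : X ⊕ Unit) = _
  simp

theorem continuous_height : Continuous (height : Susp X → ℝ) := by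
  refine isQuotientMap_proj.continuous_iff.mpr ?_
  have h : Continuous (Sum.elim (fun _ => 1) (fun _ => 0) : X ⊕ Unit → ℝ) :=
    continuous_sum_dom.mpr ⟨continuous_const, continuous_const⟩
  change Continuous fun p : (X ⊕ Unit) × I =>
    min (p.2 : ℝ) (1 - p.2) * Sum.elim (fun _ => 1) (fun _ => 0) p.1
  fun_prop

/-- The open neighbourhood of the basepoint that consists of the two outer thirds of all arcs. -/
def outer (X : Type*) : Set (Susp X) := {p | height p < 1 / 3}

/-- The complement of the basepoint: the union of the open arcs, a copy of `X × (0, 1)`. -/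
def inner (X : Type*) : Set (Susp X) := {p | 0 < height p}

theorem isOpen_outer : IsOpen (outer X) := isOpen_lt continuous_height continuous_const

theorem isOpen_inner : IsOpen (inner X) := isOpen_lt continuous_const continuous_height

theorem mem_outer_or_mem_inner {X : Type*} (p : Susp X) : p ∈ outer X ∨ p ∈ inner X := by
  rcases le_or_gt (height p) 0 with h | h
  · exact Or.inl (show height p < 1 / 3 by linarith)
  · exact Or.inr h

theorem base_mem_outer {X : Type*} : base X ∈ outer X := by
  change height (base X) < 1 / 3
  rw [height_base]; norm_num

theorem proj_inl_mem_inner {X : Type*} {x : X} {t : I} :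
    proj (Sum.inl x, t) ∈ inner X ↔ 0 < (t : ℝ) ∧ (t : ℝ) < 1 := by
  change 0 < height _ ↔ _
  rw [height_inl, lt_min_iff, sub_pos]

theorem proj_inl_mem_outer {X : Type*} {x : X} {t : I} :
    proj (Sum.inl x, t) ∈ outer X ↔ (t : ℝ) < 1 / 3 ∨ 2 / 3 < (t : ℝ) := by
  change height _ < 1 / 3 ↔ _
  rw [height_inl, min_lt_iff]
  refine or_congr Iff.rfl ⟨fun h => ?_, fun h => ?_⟩ <;> linarith

theorem eq_base_or_exists {X : Type*} (p : Susp X) :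
    p = base X ∨ ∃ (x : X) (t : I), 0 < (t : ℝ) ∧ (t : ℝ) < 1 ∧ p = proj (Sum.inl x, t) := by
  obtain ⟨⟨x | s, t⟩, rfl⟩ := proj_surjective p
  · by_cases h : 0 < (t : ℝ) ∧ (t : ℝ) < 1
    · exact Or.inr ⟨x, t, h.1, h.2, rfl⟩
    · refine Or.inl (proj_eq_base (Or.inr ?_))
      by_contra h'
      push Not at h'
      exact h ⟨lt_of_le_of_ne t.2.1 fun e => h'.1 (Subtype.ext e.symm),
        lt_of_le_of_ne t.2.2 fun e => h'.2 (Subtype.ext e)⟩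
  · exact Or.inl (proj_eq_base (Or.inl ⟨s, rfl⟩))

theorem exists_of_mem_inner {X : Type*} {p : Susp X} (hp : p ∈ inner X) :
    ∃ (x : X) (t : I), 0 < (t : ℝ) ∧ (t : ℝ) < 1 ∧ p = proj (Sum.inl x, t) := by
  refine (eq_base_or_exists p).resolve_left ?_
  rintro rfl
  have : 0 < height (base X) := hp
  rw [height_base] at this
  exact lt_irrefl _ this

open Classical in
/-- A section of the quotient map `X₊ × I → Σ(X₊)`.  It is continuous away from the basepoint. -/
noncomputable def coord : Susp X → (X ⊕ Unit) × I :=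
  Quotient.lift (fun p => if p ∈ suspCollapse X then (Sum.inr (), 0) else p) (by
    rintro p q (rfl | ⟨h1, h2⟩)
    · rfl
    · simp only [h1, h2, if_true])

theorem coord_proj {X : Type*} {x : X} {t : I} (h0 : 0 < (t : ℝ)) (h1 : (t : ℝ) < 1) :
    coord (proj (Sum.inl x, t)) = (Sum.inl x, t) := by
  refine if_neg ?_
  rintro (⟨s, hs⟩ | h | h)
  · cases hs
  · simp only at h; simp [h] at h0
  · simp only at h; simp [h] at h1

theorem coord_base {X : Type*} : coord (base X) = (Sum.inr (), 0) := if_pos (Or.inl ⟨(), rfl⟩)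

theorem proj_coord {X : Type*} {p : Susp X} (hp : p ∈ inner X) : proj (coord p) = p := by
  obtain ⟨x, t, h0, h1, rfl⟩ := exists_of_mem_inner hp
  rw [coord_proj h0 h1]

theorem continuousOn_coord : ContinuousOn coord (inner X) := by
  refine (isQuotientMap_proj.continuousOn_isOpen_iff isOpen_inner).mpr ?_
  refine continuousOn_id.congr ?_
  rintro ⟨x | s, t⟩ hp
  · obtain ⟨h0, h1⟩ := proj_inl_mem_inner.mp hp
    exact coord_proj h0 h1
  · have : 0 < height (proj (Sum.inr s, t) : Susp X) := hp
    rw [proj_eq_base (Or.inl ⟨s, rfl⟩), height_base] at this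
    exact absurd this (lt_irrefl _)

/-! ### The letter of a point -/

/-- The word of length at most one that is recorded when a path moves from the lower half of an arc
to the given point without leaving the arc: it is `x` on the upper half of the arc of `x`, and empty
elsewhere. -/
noncomputable def crossing (p : Susp X) : Words X :=
  Sum.elim (fun x => if 1 / 2 < ((coord p).2 : ℝ) then Words.single x else Words.nil X)
    (fun _ => Words.nil X) (coord p).1

theorem crossing_of_le {X : Type*} {x : X} {t : I} (h0 : 0 < (t : ℝ)) (h : (t : ℝ) ≤ 1 / 2) :
    crossing (proj (Sum.inl x, t)) = Words.nil X := by
  rw [crossing, coord_proj h0 (by linarith)]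
  exact if_neg (not_lt.mpr h)

theorem crossing_of_lt {X : Type*} {x : X} {t : I} (h : 1 / 2 < (t : ℝ)) (h1 : (t : ℝ) < 1) :
    crossing (proj (Sum.inl x, t)) = Words.single x := by
  rw [crossing, coord_proj (by linarith) h1]
  exact if_pos h

theorem continuousOn_crossing : ContinuousOn crossing (outer X ∩ inner X) := by
  have key : ContinuousOn (fun q : (X ⊕ Unit) × I =>
      Sum.elim (fun x => if 1 / 2 < (q.2 : ℝ) then Words.single x else Words.nil X)
        (fun _ => Words.nil X) q.1) {q | (q.2 : ℝ) ≠ 1 / 2} := by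
    rintro ⟨x | s, t⟩ ht
    · have hx : ∀ᶠ q : (X ⊕ Unit) × I in 𝓝 (Sum.inl x, t), q.1 ∈ Set.range Sum.inl :=
        (isOpen_range_inl.preimage continuous_fst).mem_nhds ⟨x, rfl⟩
      refine ContinuousAt.continuousWithinAt ?_
      rcases lt_or_gt_of_ne (show (t : ℝ) ≠ 1 / 2 from ht) with h | h
      · have ht' : ∀ᶠ q : (X ⊕ Unit) × I in 𝓝 (Sum.inl x, t), (q.2 : ℝ) < 1 / 2 :=
          (isOpen_lt (f := fun q : (X ⊕ Unit) × I => (q.2 : ℝ)) (by fun_prop)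
            continuous_const).mem_nhds h
        refine (continuousAt_const (y := Words.nil X)).congr ?_
        filter_upwards [hx, ht'] with q hq hq'
        obtain ⟨y, hy⟩ := hq
        rw [← hy]
        exact (if_neg (not_lt.mpr hq'.le)).symm
      · have ht' : ∀ᶠ q : (X ⊕ Unit) × I in 𝓝 (Sum.inl x, t), 1 / 2 < (q.2 : ℝ) :=
          (isOpen_lt (g := fun q : (X ⊕ Unit) × I => (q.2 : ℝ)) continuous_const
            (by fun_prop)).mem_nhds h
        have hc : Continuous (Sum.elim Words.single (fun _ => Words.nil X) : X ⊕ Unit → Words X) :=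
          continuous_sum_dom.mpr ⟨Words.continuous_single, continuous_const⟩
        refine (hc.comp continuous_fst).continuousAt.congr ?_
        filter_upwards [hx, ht'] with q hq hq'
        obtain ⟨y, hy⟩ := hq
        simp only [Function.comp, ← hy]
        exact (if_pos hq').symm
    · have hx : ∀ᶠ q : (X ⊕ Unit) × I in 𝓝 (Sum.inr s, t), q.1 ∈ Set.range Sum.inr :=
        (isOpen_range_inr.preimage continuous_fst).mem_nhds ⟨s, rfl⟩
      refine (continuousAt_const (y := Words.nil X)).congr ?_ |>.continuousWithinAt
      filter_upwards [hx] with q hq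
      obtain ⟨y, hy⟩ := hq
      rw [← hy]
      rfl
  refine key.comp (continuousOn_coord.mono Set.inter_subset_right) ?_
  rintro p ⟨ho, hi⟩
  obtain ⟨x, t, h0, h1, rfl⟩ := exists_of_mem_inner hi
  rw [coord_proj h0 h1]
  rcases proj_inl_mem_outer.mp ho with h | h
  · exact (show (t : ℝ) < 1 / 2 by linarith).ne
  · exact (show 1 / 2 < (t : ℝ) by linarith).ne'

/-! ### Radial paths -/

/-- The homotopy of the arc `[0, 1]` that expands the middle third to the whole arc; at time `1` it
is the identity, and at time `0` it collapses the two outer thirds to the endpoints. -/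
noncomputable def expand (s t : I) : I :=
  Set.projIcc 0 1 zero_le_one ((3 - 2 * (s : ℝ)) * t - (1 - s))

theorem continuous_expand : Continuous fun q : I × I => expand q.1 q.2 :=
  continuous_projIcc.comp (by fun_prop)

theorem expand_of_eq_zero (s : I) : expand s 0 = 0 :=
  Set.projIcc_of_le_left _ (by have := s.2.2; simp; linarith)

theorem expand_of_eq_one (s : I) : expand s 1 = 1 :=
  Set.projIcc_of_right_le _ (by have := s.2.2; simp; linarith)

theorem expand_one (t : I) : expand 1 t = t := by
  have h : (3 - 2 * ((1 : I) : ℝ)) * t - (1 - ((1 : I) : ℝ)) = t := by simp; ring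
  rw [expand, h, Set.projIcc_val]

theorem expand_zero_of_lt {t : I} (h : (t : ℝ) < 1 / 3) : expand 0 t = 0 :=
  Set.projIcc_of_le_left _ (by simp; linarith)

theorem expand_zero_of_gt {t : I} (h : 2 / 3 < (t : ℝ)) : expand 0 t = 1 :=
  Set.projIcc_of_right_le _ (by simp; linarith)

/-- The homotopy of the suspension that is `Susp.expand` on each arc. -/
noncomputable def push (s : I) : Susp X → Susp X :=
  Quotient.lift (fun p => proj (p.1, expand s p.2)) (by
    have key : ∀ p ∈ suspCollapse X, proj (p.1, expand s p.2) = base X := by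
      rintro ⟨a, t⟩ (⟨i, rfl⟩ | h | h)
      · exact proj_eq_base (Or.inl ⟨i, rfl⟩)
      · simp only at h
        exact proj_eq_base (Or.inr (Or.inl (by simp [h, expand_of_eq_zero])))
      · simp only at h
        exact proj_eq_base (Or.inr (Or.inr (by simp [h, expand_of_eq_one])))
    rintro p q (rfl | ⟨h1, h2⟩)
    · rfl
    · exact (key p h1).trans (key q h2).symm)

theorem push_proj {X : Type*} (s : I) (p : (X ⊕ Unit) × I) :
    push s (proj p) = proj (p.1, expand s p.2) := rfl

theorem push_base {X : Type*} (s : I) : push s (base X) = base X := by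
  rw [base, push_proj]
  exact proj_eq_base (Or.inl ⟨(), rfl⟩)

theorem push_one {X : Type*} (p : Susp X) : push 1 p = p := by
  obtain ⟨q, rfl⟩ := proj_surjective p
  rw [push_proj, expand_one]

theorem push_zero {X : Type*} {p : Susp X} (hp : p ∈ outer X) : push 0 p = base X := by
  rcases eq_base_or_exists p with rfl | ⟨x, t, -, -, rfl⟩
  · exact push_base 0
  · rw [push_proj]
    rcases proj_inl_mem_outer.mp hp with h | h
    · exact proj_eq_base (Or.inr (Or.inl (expand_zero_of_lt h)))
    · exact proj_eq_base (Or.inr (Or.inr (expand_zero_of_gt h)))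

theorem continuous_push : Continuous fun q : Susp X × I => push q.2 q.1 := by
  refine isQuotientMap_proj.continuous_lift_prod_left (g := fun q : Susp X × I => push q.2 q.1) ?_
  simp only [push_proj]
  exact isQuotientMap_proj.continuous.comp
    ((continuous_fst.comp continuous_fst).prodMk
      (continuous_expand.comp (continuous_snd.prodMk (continuous_snd.comp continuous_fst))))

/-- The path from the basepoint to a point of `Susp.outer` along the shorter part of its arc. -/
noncomputable def shortPath {p : Susp X} (hp : p ∈ outer X) : Path (base X) p where
  toFun s := push s p
  continuous_toFun := continuous_push.comp (continuous_const.prodMk continuous_id)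
  source' := push_zero hp
  target' := push_one p

/-- The path from the basepoint to a point of `Susp.inner` along the lower part of its arc. -/
noncomputable def lowerPath {p : Susp X} (hp : p ∈ inner X) : Path (base X) p where
  toFun s := proj ((coord p).1, s * (coord p).2)
  continuous_toFun := isQuotientMap_proj.continuous.comp (by fun_prop)
  source' := proj_eq_base (Or.inr (Or.inl (zero_mul _)))
  target' := by rw [one_mul]; exact proj_coord hp

theorem continuous_shortPath :
    Continuous fun q : outer X × I => shortPath q.1.2 q.2 :=
  continuous_push.comp (by fun_prop : Continuous fun q : outer X × I => ((q.1 : Susp X), q.2))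

theorem continuous_lowerPath :
    Continuous fun q : inner X × I => lowerPath q.1.2 q.2 := by
  have h : Continuous fun q : inner X × I => coord (q.1 : Susp X) :=
    (continuousOn_iff_continuous_domRestrict.mp continuousOn_coord).comp continuous_fst
  exact isQuotientMap_proj.continuous.comp
    (h.fst.prodMk (continuous_snd.mul h.snd))

/-- Paths which run inside one arc of the suspension are homotopic as soon as their lifts to the
arc have the same endpoints. -/
theorem homotopic_of_arc {a b : Susp X} {P Q : Path a b} (x : X) (f g : C(I, I))
    (hP : ∀ t, P t = proj (Sum.inl x, f t)) (hQ : ∀ t, Q t = proj (Sum.inl x, g t))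
    (h0 : f 0 = g 0) (h1 : f 1 = g 1) : P.Homotopic Q := by
  have hc : Continuous fun q : I × I => proj (Sum.inl x,
      (Set.Icc.convexComb (f q.2) (g q.2) q.1 : I)) :=
    isQuotientMap_proj.continuous.comp (continuous_const.prodMk (by fun_prop))
  refine ⟨⟨⟨⟨fun q => proj (Sum.inl x, (Set.Icc.convexComb (f q.2) (g q.2) q.1 : I)), hc⟩,
    ?_, ?_⟩, ?_⟩⟩
  · intro t; simp [hP]
  · intro t; simp [hQ]
  · rintro s t (rfl | rfl)
    · simp [← h0, hP]
    · simp [← h1, hP]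

end Susp

open Set

/-! ### Lifts of paths in the suspension to a group -/

section Lift

theorem joinedIn_Icc {a b : I} (hab : a ≤ b) : JoinedIn (Icc a b) a b :=
  ⟨⟨⟨fun t => Icc.convexComb a b t, by fun_prop⟩, by simp, by simp⟩,
    fun t => ⟨Icc.le_convexComb hab t, Icc.convexComb_le hab t⟩⟩

variable {X : Type*} {H : Type*} [Group H]

/-- The value in `H` of the letter recorded by `Susp.crossing`. -/
noncomputable def potential (f : X → H) (p : Susp X) : H := wordEval f (Susp.crossing p)

/-- A lift of the path `γ` to `H`, starting at `1`, in the `H`-bundle over the suspension that is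
trivial over `Susp.outer` and `Susp.inner` and has `potential f` as transition function between the
two trivializations. The values of `g` are the coordinates in the first trivialization, and
`g t * (potential f (γ t))⁻¹` those in the second one. Since `H` carries no topology and `f` is
arbitrary, that a lift is horizontal is expressed on time intervals: the coordinate in a
trivialization is the same at both ends of every interval that `γ` maps into its domain. -/
structure IsLift (γ : I → Susp X) (f : X → H) (g : I → H) : Prop where
  map_zero : g 0 = 1
  outer : ∀ a b, a ≤ b → MapsTo γ (Icc a b) (Susp.outer X) → g a = g b
  inner : ∀ a b, a ≤ b → MapsTo γ (Icc a b) (Susp.inner X) →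
    g a * (potential f (γ a))⁻¹ = g b * (potential f (γ b))⁻¹

/-- The restriction of a lift to a part of the time interval, translated so as to start at `1`, is a
lift. -/
theorem IsLift.reparam {γ γ' : I → Susp X} {f : X → H} {g : I → H} (h : IsLift γ' f g)
    {e : I → I} (hm : Monotone e) (hc : Continuous e) (he : ∀ t, γ' (e t) = γ t) :
    IsLift γ f fun t => (g (e 0))⁻¹ * g (e t) := by
  have key : ∀ {a b : I} {U : Set (Susp X)}, a ≤ b → MapsTo γ (Icc a b) U →
      MapsTo γ' (Icc (e a) (e b)) U := by
    intro a b U hab hU s hs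
    obtain ⟨t, ht, rfl⟩ := intermediate_value_Icc hab hc.continuousOn hs
    rw [he]
    exact hU ht
  refine ⟨inv_mul_cancel _, fun a b hab hU => ?_, fun a b hab hU => ?_⟩
  · simp only [h.outer _ _ (hm hab) (key hab hU)]
  · have := h.inner _ _ (hm hab) (key hab hU)
    rw [he, he] at this
    simp only [mul_assoc, this]

variable [TopologicalSpace X]

/-- Induction along a path in the suspension, by the Lebesgue number lemma. -/
theorem cover_induction {γ : I → Susp X} (hγ : Continuous γ) {Q : I → Prop} (h0 : Q 0)
    (ho : ∀ a b, a ≤ b → MapsTo γ (Icc a b) (Susp.outer X) → Q a → Q b)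
    (hi : ∀ a b, a ≤ b → MapsTo γ (Icc a b) (Susp.inner X) → Q a → Q b) : Q 1 := by
  obtain ⟨t, ht0, htm, ⟨n, hn⟩, ht⟩ := exists_monotone_Icc_subset_open_cover_unitInterval
    (c := fun b : Bool => γ ⁻¹' (cond b (Susp.outer X) (Susp.inner X)))
    (by rintro (_ | _)
        · exact Susp.isOpen_inner.preimage hγ
        · exact Susp.isOpen_outer.preimage hγ)
    (fun s _ => mem_iUnion.mpr <| (Susp.mem_outer_or_mem_inner (γ s)).elim
      (fun h => ⟨true, h⟩) fun h => ⟨false, h⟩)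
  have key : ∀ k, Q (t k) := by
    intro k
    induction k with
    | zero => rwa [ht0]
    | succ k ih =>
      obtain ⟨_ | _, hb⟩ := ht k
      · exact hi _ _ (htm k.le_succ) hb ih
      · exact ho _ _ (htm k.le_succ) hb ih
  rw [← hn n le_rfl]
  exact key n

theorem IsLift.apply_one_eq {γ : I → Susp X} (hγ : Continuous γ) {f : X → H} {g g' : I → H}
    (h : IsLift γ f g) (h' : IsLift γ f g') : g 1 = g' 1 := by
  refine cover_induction hγ (Q := fun t => g t = g' t) (h.map_zero.trans h'.map_zero.symm) ?_ ?_
  · intro a b hab hU hQ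
    rw [← h.outer a b hab hU, ← h'.outer a b hab hU, hQ]
  · intro a b hab hU hQ
    have e := h.inner a b hab hU
    rw [hQ, h'.inner a b hab hU] at e
    exact (mul_right_cancel e).symm

/-- On the overlap of the two pieces, the transition function is constant along paths. -/
theorem potential_eq_of_mapsTo {γ : I → Susp X} (hγ : Continuous γ) {f : X → H}
    (hf : ∀ x y, Joined x y → f x = f y) {a b : I} (hab : a ≤ b)
    (ho : MapsTo γ (Icc a b) (Susp.outer X)) (hi : MapsTo γ (Icc a b) (Susp.inner X)) :
    potential f (γ a) = potential f (γ b) := by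
  refine wordEval_eq_of_joined hf ?_
  exact ((joinedIn_Icc hab).map_continuousOn (f := fun t => Susp.crossing (γ t))
    (Susp.continuousOn_crossing.comp hγ.continuousOn fun t ht => ⟨ho ht, hi ht⟩)).joined

/-- To see that `F` agrees at the ends of every interval up to `d` that `γ` maps into `U`, it
suffices to treat the intervals on either side of `c`. -/
theorem eq_of_split_at {Y D : Type*} {γ : I → Y} {U : Set Y} {d : I} (F : I → D) (c : I)
    (h1 : ∀ a b, a ≤ b → b ≤ c → MapsTo γ (Icc a b) U → F a = F b)
    (h2 : ∀ a b, a ≤ b → c ≤ a → b ≤ d → MapsTo γ (Icc a b) U → F a = F b) :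
    ∀ a b, a ≤ b → b ≤ d → MapsTo γ (Icc a b) U → F a = F b := by
  intro a b hab hb hU
  rcases le_total b c with hbc | hbc
  · exact h1 a b hab hbc hU
  · rcases le_total c a with hca | hca
    · exact h2 a b hab hca hb hU
    · exact (h1 a c hca le_rfl (hU.mono_left (Icc_subset_Icc le_rfl hbc))).trans
        (h2 c b hbc le_rfl hb (hU.mono_left (Icc_subset_Icc hca le_rfl)))

/-- If `f` is constant on path components, every path has a lift. -/
theorem exists_isLift {γ : I → Susp X} (hγ : Continuous γ) {f : X → H}
    (hf : ∀ x y, Joined x y → f x = f y) : ∃ g, IsLift γ f g := by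
  suffices h : ∃ g : I → H, g 0 = 1 ∧
      (∀ a b, a ≤ b → b ≤ 1 → MapsTo γ (Icc a b) (Susp.outer X) → g a = g b) ∧
      (∀ a b, a ≤ b → b ≤ 1 → MapsTo γ (Icc a b) (Susp.inner X) →
        g a * (potential f (γ a))⁻¹ = g b * (potential f (γ b))⁻¹) by
    obtain ⟨g, h0, ho, hi⟩ := h
    exact ⟨g, h0, fun a b hab => ho a b hab b.2.2, fun a b hab => hi a b hab b.2.2⟩
  refine cover_induction hγ (Q := fun c => ∃ g : I → H, g 0 = 1 ∧
      (∀ a b, a ≤ b → b ≤ c → MapsTo γ (Icc a b) (Susp.outer X) → g a = g b) ∧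
      (∀ a b, a ≤ b → b ≤ c → MapsTo γ (Icc a b) (Susp.inner X) →
        g a * (potential f (γ a))⁻¹ = g b * (potential f (γ b))⁻¹)) ?_ ?_ ?_
  · refine ⟨fun _ => 1, rfl, fun a b _ _ _ => rfl, fun a b hab hb _ => ?_⟩
    rw [le_antisymm hab (hb.trans a.2.1)]
  · rintro c d hcd hU ⟨g, h0, ho, hi⟩
    -- A lift up to time `c` is continued by a constant while `γ` stays in `Susp.outer`.
    refine ⟨fun t => g (min t c), ?_, ?_, ?_⟩
    · simpa using h0
    · refine eq_of_split_at (fun t => g (min t c)) c (fun a b hab hb hV => ?_)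
        fun a b hab ha hb hV => ?_
      · rw [min_eq_left hb, min_eq_left (hab.trans hb)]
        exact ho a b hab hb hV
      · rw [min_eq_right ha, min_eq_right (ha.trans hab)]
    · refine eq_of_split_at (fun t => g (min t c) * (potential f (γ t))⁻¹) c
        (fun a b hab hb hV => ?_) fun a b hab ha hb hV => ?_
      · rw [min_eq_left hb, min_eq_left (hab.trans hb)]
        exact hi a b hab hb hV
      · rw [min_eq_right ha, min_eq_right (ha.trans hab),
          potential_eq_of_mapsTo hγ hf hab (hU.mono_left (Icc_subset_Icc ha hb)) hV]
  · rintro c d hcd hU ⟨g, h0, ho, hi⟩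
    -- While `γ` stays in `Susp.inner`, the coordinate over `Susp.inner` is kept constant.
    refine ⟨fun t => g (min t c) * (potential f (γ (min t c)))⁻¹ * potential f (γ t), ?_, ?_, ?_⟩
    · simpa using h0
    · refine eq_of_split_at
        (fun t => g (min t c) * (potential f (γ (min t c)))⁻¹ * potential f (γ t)) c
        (fun a b hab hb hV => ?_) fun a b hab ha hb hV => ?_
      · rw [min_eq_left hb, min_eq_left (hab.trans hb), inv_mul_cancel_right,
          inv_mul_cancel_right]
        exact ho a b hab hb hV
      · rw [min_eq_right ha, min_eq_right (ha.trans hab),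
          potential_eq_of_mapsTo hγ hf hab hV (hU.mono_left (Icc_subset_Icc ha hb))]
    · simp only [mul_inv_cancel_right]
      refine eq_of_split_at (fun t => g (min t c) * (potential f (γ (min t c)))⁻¹) c
        (fun a b hab hb hV => ?_) fun a b hab ha hb hV => ?_
      · rw [min_eq_left hb, min_eq_left (hab.trans hb)]
        exact hi a b hab hb hV
      · rw [min_eq_right ha, min_eq_right (ha.trans hab)]

end Lift

/-! ### Local words of loops -/

section LocalWords

variable {X : Type u} [TopologicalSpace X]

/-- Near the loop `α`, the value of a lift at time `t` is given by a continuously varying word,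
independently of the group in which the lift takes values. -/
def HasOuterWord (α : Path (Susp.base X) (Susp.base X)) (t : I) : Prop :=
  ∃ (N : Set (Path (Susp.base X) (Susp.base X))) (w : Path (Susp.base X) (Susp.base X) → Words X),
    IsOpen N ∧ α ∈ N ∧ ContinuousOn w N ∧
      ∀ β ∈ N, ∀ (H : Type u) [Group H] (f : X → H) (g : I → H), IsLift β f g →
        g t = wordEval f (w β)

/-- The analogue of `HasOuterWord` for the value of a lift in the trivialization over
`Susp.inner`. -/
def HasInnerWord (α : Path (Susp.base X) (Susp.base X)) (t : I) : Prop :=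
  ∃ (N : Set (Path (Susp.base X) (Susp.base X))) (w : Path (Susp.base X) (Susp.base X) → Words X),
    IsOpen N ∧ α ∈ N ∧ ContinuousOn w N ∧
      ∀ β ∈ N, ∀ (H : Type u) [Group H] (f : X → H) (g : I → H), IsLift β f g →
        g t * (potential f (β t))⁻¹ = wordEval f (w β)

theorem Path.isOpen_mapsTo {Y : Type*} [TopologicalSpace Y] {x y : Y} {K : Set I} {U : Set Y}
    (hK : IsCompact K) (hU : IsOpen U) : IsOpen {β : Path x y | MapsTo β K U} :=
  (ContinuousMap.isOpen_setOfPred_mapsTo hK hU).preimage continuous_induced_dom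

theorem continuousOn_crossing_eval (t : I) :
    ContinuousOn (fun β : Path (Susp.base X) (Susp.base X) => Susp.crossing (β t))
      {β | β t ∈ Susp.outer X ∩ Susp.inner X} :=
  Susp.continuousOn_crossing.comp (continuous_eval_const t).continuousOn fun _ h => h

variable {α : Path (Susp.base X) (Susp.base X)} {a b t : I}

theorem isOpen_eval_mem_overlap (t : I) : IsOpen {β : Path (Susp.base X) (Susp.base X) |
    β t ∈ Susp.outer X ∩ Susp.inner X} :=
  (Susp.isOpen_outer.inter Susp.isOpen_inner).preimage (continuous_eval_const t)

theorem HasOuterWord.hasInnerWord (h : HasOuterWord α t)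
    (ht : α t ∈ Susp.outer X ∩ Susp.inner X) : HasInnerWord α t := by
  obtain ⟨N, w, hN, hα, hw, hg⟩ := h
  refine ⟨N ∩ {β | β t ∈ Susp.outer X ∩ Susp.inner X},
    fun β => (w β).append (Susp.crossing (β t)).inv, hN.inter (isOpen_eval_mem_overlap t),
    ⟨hα, ht⟩, ?_, ?_⟩
  · exact Words.continuous_append.comp_continuousOn ((hw.mono inter_subset_left).prodMk
      (Words.continuous_inv.comp_continuousOn
        ((continuousOn_crossing_eval t).mono inter_subset_right)))
  · intro β hβ H _ f g hl
    rw [wordEval_append, wordEval_inv, hg β hβ.1 H f g hl, potential]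

theorem HasInnerWord.hasOuterWord (h : HasInnerWord α t)
    (ht : α t ∈ Susp.outer X ∩ Susp.inner X) : HasOuterWord α t := by
  obtain ⟨N, w, hN, hα, hw, hg⟩ := h
  refine ⟨N ∩ {β | β t ∈ Susp.outer X ∩ Susp.inner X},
    fun β => (w β).append (Susp.crossing (β t)), hN.inter (isOpen_eval_mem_overlap t),
    ⟨hα, ht⟩, ?_, ?_⟩
  · exact Words.continuous_append.comp_continuousOn ((hw.mono inter_subset_left).prodMk
      ((continuousOn_crossing_eval t).mono inter_subset_right))
  · intro β hβ H _ f g hl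
    rw [wordEval_append, ← hg β hβ.1 H f g hl, potential, inv_mul_cancel_right]

theorem HasOuterWord.step (h : HasOuterWord α a) (hab : a ≤ b)
    (hU : MapsTo α (Icc a b) (Susp.outer X)) : HasOuterWord α b := by
  obtain ⟨N, w, hN, hα, hw, hg⟩ := h
  refine ⟨N ∩ {β | MapsTo β (Icc a b) (Susp.outer X)}, w,
    hN.inter (Path.isOpen_mapsTo isCompact_Icc Susp.isOpen_outer), ⟨hα, hU⟩,
    hw.mono inter_subset_left, ?_⟩
  intro β hβ H _ f g hl
  rw [← hl.outer a b hab hβ.2, hg β hβ.1 H f g hl]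

theorem HasInnerWord.step (h : HasInnerWord α a) (hab : a ≤ b)
    (hU : MapsTo α (Icc a b) (Susp.inner X)) : HasInnerWord α b := by
  obtain ⟨N, w, hN, hα, hw, hg⟩ := h
  refine ⟨N ∩ {β | MapsTo β (Icc a b) (Susp.inner X)}, w,
    hN.inter (Path.isOpen_mapsTo isCompact_Icc Susp.isOpen_inner), ⟨hα, hU⟩,
    hw.mono inter_subset_left, ?_⟩
  intro β hβ H _ f g hl
  rw [← hl.inner a b hab hβ.2, hg β hβ.1 H f g hl]

/-- Every loop has a neighbourhood on which the endpoints of lifts are given by a continuously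
varying word. -/
theorem hasOuterWord_one (α : Path (Susp.base X) (Susp.base X)) : HasOuterWord α 1 := by
  suffices h : (α 1 ∈ Susp.outer X → HasOuterWord α 1) ∧
      (α 1 ∈ Susp.inner X → HasInnerWord α 1) from
    h.1 (by rw [α.target]; exact Susp.base_mem_outer)
  refine cover_induction α.continuous (Q := fun t => (α t ∈ Susp.outer X → HasOuterWord α t) ∧
      (α t ∈ Susp.inner X → HasInnerWord α t)) ?_ ?_ ?_
  · have h0 : HasOuterWord α 0 :=
      ⟨univ, fun _ => Words.nil X, isOpen_univ, mem_univ _, continuousOn_const,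
        fun β _ H _ f g hl => by rw [hl.map_zero, wordEval_nil]⟩
    refine ⟨fun _ => h0, fun h => h0.hasInnerWord ⟨?_, h⟩⟩
    rw [α.source]; exact Susp.base_mem_outer
  · intro a b hab hU h
    have hb := (h.1 (hU (left_mem_Icc.mpr hab))).step hab hU
    exact ⟨fun _ => hb, fun hi => hb.hasInnerWord ⟨hU (right_mem_Icc.mpr hab), hi⟩⟩
  · intro a b hab hU h
    have hb := (h.2 (hU (left_mem_Icc.mpr hab))).step hab hU
    exact ⟨fun ho => hb.hasOuterWord ⟨ho, hU (right_mem_Icc.mpr hab)⟩, fun _ => hb⟩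

end LocalWords

/-! ### The lift of a loop to the fundamental group -/

section PiOneLift

variable {X : Type u} [TopologicalSpace X]

/-- The initial segment of a path. -/
def initial {Y : Type*} [TopologicalSpace Y] {x y : Y} (γ : Path x y) (s : I) : Path x (γ s) where
  toFun t := γ (s * t)
  continuous_toFun := by fun_prop
  source' := by simp
  target' := by simp

theorem continuous_initial {Y : Type*} [TopologicalSpace Y] {x y : Y} (γ : Path x y) :
    Continuous fun q : I × I => initial γ q.1 q.2 :=
  γ.continuous.comp (by fun_prop)

variable (γ : Path (Susp.base X) (Susp.base X))

/-- The class of the loop that follows `γ` up to time `s` and returns along the shorter part of the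
arc. -/
noncomputable def outerClass {s : I} (hs : γ s ∈ Susp.outer X) : PiOneTop (Susp X) (Susp.base X) :=
  ZerothHomotopy.mk ((initial γ s).trans (Susp.shortPath hs).symm)

/-- The class of the loop that follows `γ` up to time `s` and returns along the lower part of the
arc. -/
noncomputable def innerClass {s : I} (hs : γ s ∈ Susp.inner X) : PiOneTop (Susp X) (Susp.base X) :=
  ZerothHomotopy.mk ((initial γ s).trans (Susp.lowerPath hs).symm)

/-- A continuous family of return paths, defined over a set `U`, gives loops in the same path
component along every time interval that `γ` spends in `U`. -/
theorem mk_trans_symm_eq {Y : Type*} [TopologicalSpace Y] {x : Y} (γ : Path x x) {U : Set Y}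
    (c : ∀ p : U, Path x (p : Y)) (hc : Continuous fun q : U × I => c q.1 q.2) {a b : I}
    (hab : a ≤ b) (hU : MapsTo γ (Icc a b) U) :
    (ZerothHomotopy.mk ((initial γ a).trans (c ⟨γ a, hU (left_mem_Icc.mpr hab)⟩).symm) :
      PiOneTop Y x) =
    ZerothHomotopy.mk ((initial γ b).trans (c ⟨γ b, hU (right_mem_Icc.mpr hab)⟩).symm) := by
  let F : Icc a b → Path x x := fun s => (initial γ s).trans (c ⟨γ s, hU s.2⟩).symm
  have hF : Continuous F := by
    refine Path.continuous_uncurry_iff.mp (Path.trans_continuous_family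
      (fun s : Icc a b => initial γ s) ?_ (fun s => (c ⟨γ s, hU s.2⟩).symm)
      (Path.symm_continuous_family (fun s : Icc a b => c ⟨γ s, hU s.2⟩) ?_))
    · exact (continuous_initial γ).comp
        (by fun_prop : Continuous fun q : Icc a b × I => ((q.1 : I), q.2))
    · refine hc.comp (g := fun q : U × I => c q.1 q.2)
        (f := fun q : Icc a b × I => ((⟨γ q.1, hU q.1.2⟩ : U), q.2)) ?_
      fun_prop
  have hj := (joinedIn_iff_joined (left_mem_Icc.mpr hab) (right_mem_Icc.mpr hab)).mp
    (joinedIn_Icc hab)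
  exact Quotient.sound (hj.map hF)

theorem outerClass_eq {a b : I} (hab : a ≤ b) (hU : MapsTo γ (Icc a b) (Susp.outer X)) :
    outerClass γ (hU (left_mem_Icc.mpr hab)) = outerClass γ (hU (right_mem_Icc.mpr hab)) :=
  mk_trans_symm_eq γ (fun p : Susp.outer X => Susp.shortPath p.2) Susp.continuous_shortPath hab hU

theorem innerClass_eq {a b : I} (hab : a ≤ b) (hU : MapsTo γ (Icc a b) (Susp.inner X)) :
    innerClass γ (hU (left_mem_Icc.mpr hab)) = innerClass γ (hU (right_mem_Icc.mpr hab)) :=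
  mk_trans_symm_eq γ (fun p : Susp.inner X => Susp.lowerPath p.2) Susp.continuous_lowerPath hab hU

/-- The class of the loop `u_x`. -/
noncomputable def loopClass (x : X) : PiOneTop (Susp X) (Susp.base X) :=
  ZerothHomotopy.mk (Susp.loop x)

/-- The path `t ↦ t * s` from `0` to `s` in the unit interval. -/
def radial (s : I) : Path (0 : I) s where
  toFun t := t * s
  continuous_toFun := by fun_prop
  source' := by simp
  target' := by simp

theorem outerClass_eq_innerClass_mul {s : I} (ho : γ s ∈ Susp.outer X) (hi : γ s ∈ Susp.inner X) :
    outerClass γ ho = innerClass γ hi * potential loopClass (γ s) := by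
  obtain ⟨x, t, h0, h1, hx⟩ := Susp.exists_of_mem_inner hi
  have hpush : ∀ r, Susp.shortPath ho r = Susp.proj (Sum.inl x, Susp.expand r t) := by
    intro r
    change Susp.push r (γ s) = _
    rw [hx, Susp.push_proj]
  have hlow : ∀ r, Susp.lowerPath hi r = Susp.proj (Sum.inl x, r * t) := by
    intro r
    change Susp.proj ((Susp.coord (γ s)).1, r * (Susp.coord (γ s)).2) = _
    rw [hx, Susp.coord_proj h0 h1]
  have hexp : Continuous fun r => Susp.expand r t :=
    Susp.continuous_expand.comp (continuous_id.prodMk continuous_const)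
  -- On the lower part of the arc the two return paths are homotopic. On the upper part, the shorter
  -- return path is homotopic to the lower one followed by `u_x`.
  rcases Susp.proj_inl_mem_outer.mp (hx ▸ ho) with h | h
  · have hp : potential loopClass (γ s) = 1 := by
      rw [potential, hx, Susp.crossing_of_le h0 (by linarith), wordEval_nil]
    rw [hp, mul_one]
    refine (mk_eq_mk_iff_homotopic _ _).mpr
      (Path.Homotopic.hcomp (Path.Homotopic.refl _) (Path.Homotopic.symm₂ ?_))
    refine Susp.homotopic_of_arc x ⟨_, hexp⟩ (radial t).toContinuousMap hpush hlow ?_ ?_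
    · simp [Susp.expand_zero_of_lt h]
    · simp [Susp.expand_one]
  · have hp : potential loopClass (γ s) = loopClass x := by
      rw [potential, hx, Susp.crossing_of_lt (by linarith) h1, wordEval_single]
    rw [hp, loopClass, innerClass, PiOneTop.mk_mul_mk]
    refine (mk_eq_mk_iff_homotopic _ _).mpr (Path.Homotopic.trans ?_
      (Path.Homotopic.symm ⟨Path.Homotopy.transAssoc _ _ _⟩))
    refine Path.Homotopic.hcomp (Path.Homotopic.refl _) ?_
    refine Susp.homotopic_of_arc x ⟨_, hexp.comp unitInterval.continuous_symm⟩
      ((radial t).symm.trans (radial 1)).toContinuousMap ?_ ?_ ?_ ?_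
    · intro r; exact hpush _
    · intro r
      simp only [Path.coe_toContinuousMap, Path.trans_apply]
      split_ifs
      · exact hlow _
      · change Susp.proj _ = Susp.proj _
        simp [radial]
    · simp [Susp.expand_one]
    · simp [Susp.expand_zero_of_gt h]

theorem outerClass_one :
    outerClass γ (s := 1) (by rw [γ.target]; exact Susp.base_mem_outer) = ZerothHomotopy.mk γ := by
  have h : (initial γ 1).trans (Susp.shortPath (p := γ 1)
      (by rw [γ.target]; exact Susp.base_mem_outer)).symm =
      γ.trans (Path.refl (Susp.base X)) := by
    ext r
    simp only [Path.trans_apply]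
    split_ifs
    · simp [initial]
    · change Susp.push _ (γ 1) = Susp.base X
      rw [γ.target, Susp.push_base]
  rw [outerClass, h, ← PiOneTop.mk_mul_mk]
  exact mul_one _

theorem outerClass_zero :
    outerClass γ (s := 0) (by rw [γ.source]; exact Susp.base_mem_outer) = 1 := by
  have h : (initial γ 0).trans (Susp.shortPath (p := γ 0)
      (by rw [γ.source]; exact Susp.base_mem_outer)).symm =
      (Path.refl (Susp.base X)).trans (Path.refl (Susp.base X)) := by
    ext r
    simp only [Path.trans_apply]
    split_ifs
    · simp [initial]
    · change Susp.push _ (γ 0) = Susp.base X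
      rw [γ.source, Susp.push_base]
  rw [outerClass, h, ← PiOneTop.mk_mul_mk]
  exact mul_one _

/-- The classes of the initial segments of a loop, closed up suitably, form a lift to the
fundamental group whose endpoint is the class of the loop. -/
theorem exists_isLift_loopClass : ∃ g, IsLift γ loopClass g ∧ g 1 = ZerothHomotopy.mk γ := by
  classical
  let g : I → PiOneTop (Susp X) (Susp.base X) := fun s =>
    if ho : γ s ∈ Susp.outer X then outerClass γ ho
    else innerClass γ ((Susp.mem_outer_or_mem_inner _).resolve_left ho) *
      potential loopClass (γ s)
  have go : ∀ {s} (ho : γ s ∈ Susp.outer X), g s = outerClass γ ho := fun ho => dif_pos ho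
  have gi : ∀ {s} (hi : γ s ∈ Susp.inner X),
      g s * (potential loopClass (γ s))⁻¹ = innerClass γ hi := by
    intro s hi
    rw [mul_inv_eq_iff_eq_mul]
    by_cases ho : γ s ∈ Susp.outer X
    · rw [go ho, outerClass_eq_innerClass_mul γ ho hi]
    · exact dif_neg ho
  refine ⟨g, ⟨?_, ?_, ?_⟩, ?_⟩
  · rw [go (by rw [γ.source]; exact Susp.base_mem_outer), outerClass_zero]
  · intro a b hab hU
    rw [go (hU (left_mem_Icc.mpr hab)), go (hU (right_mem_Icc.mpr hab)), outerClass_eq γ hab hU]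
  · intro a b hab hU
    rw [gi (hU (left_mem_Icc.mpr hab)), gi (hU (right_mem_Icc.mpr hab)), innerClass_eq γ hab hU]
  · rw [go (by rw [γ.target]; exact Susp.base_mem_outer), outerClass_one]

end PiOneLift

/-! ### The group isomorphism -/

section Iso

variable {X : Type u} [TopologicalSpace X]

/-- The free generator given by the path component of a point. -/
def gen (x : X) : FR (ZerothHomotopy X) := FR.of (ZerothHomotopy.mk x)

theorem gen_eq_of_joined (x y : X) (h : Joined x y) : gen x = gen y :=
  congrArg FR.of (Quotient.sound h)

/-- The endpoint of the lift of a loop to the free group on the path components. -/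
noncomputable def holonomy (γ : Path (Susp.base X) (Susp.base X)) : FR (ZerothHomotopy X) :=
  (exists_isLift γ.continuous gen_eq_of_joined).choose 1

theorem IsLift.holonomy_eq {γ : Path (Susp.base X) (Susp.base X)}
    {g : I → FR (ZerothHomotopy X)} (h : IsLift γ gen g) : holonomy γ = g 1 :=
  (exists_isLift γ.continuous gen_eq_of_joined).choose_spec.apply_one_eq γ.continuous h

/-- Near every loop there is a continuously varying word that represents both the homotopy class of
the loop and its holonomy. -/
theorem exists_local_word (α : Path (Susp.base X) (Susp.base X)) :
    ∃ (N : Set (Path (Susp.base X) (Susp.base X)))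
      (w : Path (Susp.base X) (Susp.base X) → Words X),
      IsOpen N ∧ α ∈ N ∧ ContinuousOn w N ∧ ∀ β ∈ N,
        (ZerothHomotopy.mk β : PiOneTop (Susp X) (Susp.base X)) = wordEval loopClass (w β) ∧
        holonomy β = wordEval gen (w β) := by
  obtain ⟨N, w, hN, hα, hw, h⟩ := hasOuterWord_one α
  refine ⟨N, w, hN, hα, hw, fun β hβ => ⟨?_, ?_⟩⟩
  · obtain ⟨g, hg, hg1⟩ := exists_isLift_loopClass β
    rw [← hg1, h β hβ _ _ g hg]
  · exact h β hβ _ _ _ (exists_isLift β.continuous gen_eq_of_joined).choose_spec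

/-- The holonomy is a homotopy invariant: along a path of loops the local words move along paths, so
the holonomy is locally constant. -/
theorem holonomy_eq_of_joined {γ δ : Path (Susp.base X) (Susp.base X)} (h : Joined γ δ) :
    holonomy γ = holonomy δ := by
  obtain ⟨Γ⟩ := h
  have hl : IsLocallyConstant fun s => holonomy (Γ s) := by
    rw [IsLocallyConstant.iff_eventually_eq]
    intro s
    obtain ⟨N, w, hN, hs, hw, h⟩ := exists_local_word (Γ s)
    obtain ⟨b, c, hsbc, hbc, hsub⟩ :=
      exists_Icc_mem_subset_of_mem_nhds ((hN.preimage Γ.continuous).mem_nhds hs)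
    have key : ∀ p q : I, b ≤ p → q ≤ c → p ≤ q → holonomy (Γ p) = holonomy (Γ q) := by
      intro p q hp hq hpq
      have hI : Icc p q ⊆ Γ ⁻¹' N := (Icc_subset_Icc hp hq).trans hsub
      rw [(h _ (hI (left_mem_Icc.mpr hpq))).2, (h _ (hI (right_mem_Icc.mpr hpq))).2]
      exact wordEval_eq_of_joined gen_eq_of_joined
        ((joinedIn_Icc hpq).map_continuousOn (f := fun r => w (Γ r))
          (hw.comp Γ.continuous.continuousOn hI)).joined
    filter_upwards [hbc] with t ht
    rcases le_total t s with hts | hts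
    · exact key t s ht.1 hsbc.2 hts
    · exact (key s t hsbc.1 ht.2 hts).symm
  have := hl.apply_eq_of_preconnectedSpace 0 1
  simpa using this

/-- The first half of the time interval of a concatenation. -/
noncomputable def firstHalf (t : I) : I := 
  ⟨t / 2, by linarith [t.2.1], by linarith [t.2.2]⟩

/-- The second half of the time interval of a concatenation. -/
noncomputable def secondHalf (t : I) : I :=
  ⟨(1 + t) / 2, by linarith [t.2.1], by linarith [t.2.2]⟩

theorem trans_firstHalf {Y : Type*} [TopologicalSpace Y] {x y z : Y} (γ : Path x y) (δ : Path y z)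
    (t : I) : γ.trans δ (firstHalf t) = γ t := by
  have h : ((firstHalf t : I) : ℝ) = t / 2 := rfl
  rw [Path.trans_apply, dif_pos (by rw [h]; linarith [t.2.2])]
  congr 1
  ext
  simp only [h]; ring

theorem trans_secondHalf {Y : Type*} [TopologicalSpace Y] {x y z : Y} (γ : Path x y)
    (δ : Path y z) (t : I) : γ.trans δ (secondHalf t) = δ t := by
  have h : ((secondHalf t : I) : ℝ) = (1 + t) / 2 := rfl
  rw [Path.trans_apply]
  split_ifs with hle
  · have ht : t = 0 := by
      ext
      rw [h] at hle
      exact le_antisymm (by simp; linarith) t.2.1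
    subst ht
    have e : (⟨2 * ((secondHalf 0 : I) : ℝ), (unitInterval.mul_pos_mem_iff zero_lt_two).2
      ⟨(secondHalf 0).2.1, hle⟩⟩ : I) = 1 := by
      ext; simp [h]
    rw [e, γ.target, δ.source]
  · congr 1
    ext
    simp only [h]; ring

/-- Both halves of a lift of the concatenation are lifts, up to translation, so that the endpoints
of lifts multiply. -/
theorem holonomy_trans (γ δ : Path (Susp.base X) (Susp.base X)) :
    holonomy (γ.trans δ) = holonomy γ * holonomy δ := by
  obtain ⟨g, hg⟩ := exists_isLift (γ.trans δ).continuous (gen_eq_of_joined (X := X))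
  have h1 : IsLift γ gen _ := hg.reparam (e := firstHalf)
    (fun a b hab => by
      have : (a : ℝ) ≤ b := hab
      change (a : ℝ) / 2 ≤ b / 2
      linarith)
    (Continuous.subtype_mk (by fun_prop) _) (trans_firstHalf γ δ)
  have h2 : IsLift δ gen _ := hg.reparam (e := secondHalf)
    (fun a b hab => by
      have : (a : ℝ) ≤ b := hab
      change (1 + (a : ℝ)) / 2 ≤ (1 + b) / 2
      linarith)
    (Continuous.subtype_mk (by fun_prop) _) (trans_secondHalf γ δ)
  have e0 : firstHalf 0 = 0 := by ext; simp [firstHalf]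
  have e1 : firstHalf 1 = secondHalf 0 := by ext; simp [firstHalf, secondHalf]
  have e2 : secondHalf 1 = 1 := by ext; simp [secondHalf]
  rw [hg.holonomy_eq, h1.holonomy_eq, h2.holonomy_eq, e0, e1, e2, hg.map_zero, inv_one, one_mul,
    mul_inv_cancel_left]

theorem holonomy_loop (x : X) : holonomy (Susp.loop x) = gen x := by
  obtain ⟨g, hg⟩ := exists_isLift (Susp.loop x).continuous (gen_eq_of_joined (X := X))
  -- The loop `u_x` runs in `Susp.outer` outside the time interval `[1/4, 3/4]`, on which it runs in
  -- `Susp.inner`.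
  obtain ⟨a, ha⟩ : ∃ a : I, (a : ℝ) = 1 / 4 := ⟨⟨1 / 4, by norm_num, by norm_num⟩, rfl⟩
  obtain ⟨b, hb⟩ : ∃ b : I, (b : ℝ) = 3 / 4 := ⟨⟨3 / 4, by norm_num, by norm_num⟩, rfl⟩
  have h1 := hg.outer 0 a a.2.1 fun t ht => Susp.proj_inl_mem_outer.mpr (Or.inl (by
    have : (t : ℝ) ≤ a := ht.2
    linarith))
  have h2 := hg.inner a b (by change (a : ℝ) ≤ b; linarith) fun t ht =>
    Susp.proj_inl_mem_inner.mpr (by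
      have h : (a : ℝ) ≤ t := ht.1
      have h' : (t : ℝ) ≤ b := ht.2
      constructor <;> linarith)
  have h3 := hg.outer b 1 b.2.2 fun t ht => Susp.proj_inl_mem_outer.mpr (Or.inr (by
    have : (b : ℝ) ≤ t := ht.1
    linarith))
  have pa : potential (gen (X := X)) (Susp.loop x a) = 1 := by
    change wordEval gen (Susp.crossing (Susp.proj (Sum.inl x, a))) = 1
    rw [Susp.crossing_of_le (by linarith) (by linarith), wordEval_nil]
  have pb : potential (gen (X := X)) (Susp.loop x b) = gen x := by
    change wordEval gen (Susp.crossing (Susp.proj (Sum.inl x, b))) = _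
    rw [Susp.crossing_of_lt (by linarith) (by linarith), wordEval_single]
  rw [pa, pb, inv_one, mul_one, ← h1, hg.map_zero, h3] at h2
  rw [hg.holonomy_eq]
  exact (mul_inv_eq_one.mp h2.symm)

/-- The holonomy as a homomorphism from the fundamental group. -/
noncomputable def holonomyHom : PiOneTop (Susp X) (Susp.base X) →* FR (ZerothHomotopy X) :=
  MonoidHom.mk' (Quotient.lift holonomy fun _ _ h => holonomy_eq_of_joined h) (by
    rintro ⟨γ⟩ ⟨δ⟩
    exact holonomy_trans γ δ)

theorem holonomyHom_loopClass (x : X) : holonomyHom (loopClass x) = gen x := holonomy_loop x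

theorem continuous_loop : Continuous (Susp.loop : X → Path (Susp.base X) (Susp.base X)) :=
  Path.continuous_uncurry_iff.mp (Susp.isQuotientMap_proj.continuous.comp
    ((continuous_inl.comp continuous_fst).prodMk continuous_snd))

theorem loopClass_eq_of_joined (x y : X) (h : Joined x y) : loopClass x = loopClass y :=
  Quotient.sound (h.map continuous_loop)

/-- The homomorphism from the free group on the path components that sends the component of `x` to
the class of `u_x`. -/
noncomputable def loopHom : FR (ZerothHomotopy X) →* PiOneTop (Susp X) (Susp.base X) :=
  FreeGroup.lift (Quotient.lift loopClass loopClass_eq_of_joined)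

theorem loopHom_gen (x : X) : loopHom (gen x) = loopClass x :=
  FreeGroup.lift_apply_of

theorem loopHom_wordEval (w : Words X) : loopHom (wordEval gen w) = wordEval loopClass w := by
  rw [map_wordEval]
  simp only [loopHom_gen]

theorem holonomyHom_wordEval (w : Words X) :
    holonomyHom (wordEval loopClass w) = wordEval gen w := by
  rw [map_wordEval]
  simp only [holonomyHom_loopClass]

theorem wordEval_gen (w : Words X) :
    wordEval gen w = FR.reduction (w.map ZerothHomotopy.mk) :=
  wordEval_comp ZerothHomotopy.mk FR.of w

theorem wordEval_gen_surjective :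
    Function.Surjective (wordEval gen : Words X → FR (ZerothHomotopy X)) := by
  intro g
  obtain ⟨⟨n, v⟩, rfl⟩ := FR.reduction_surjective g
  choose r hr using (ZerothHomotopy.isQuotientMap_mk (X := X)).surjective
  refine ⟨⟨n, fun i => Sum.map r r (v i)⟩, ?_⟩
  rw [wordEval_gen]
  congr 1
  simp only [Words.map, Sum.map_map]
  congr
  funext i
  rcases v i with y | y <;> simp [hr]

/-- The group isomorphism `π₁(Σ(X₊)) ≃ F(π₀(X))`. -/
noncomputable def holonomyEquiv :
    PiOneTop (Susp X) (Susp.base X) ≃* FR (ZerothHomotopy X) where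
  toFun := holonomyHom
  invFun := loopHom
  left_inv := by
    rintro ⟨γ⟩
    obtain ⟨N, w, -, hγ, -, h⟩ := exists_local_word γ
    have h1 := (h γ hγ).1
    change loopHom (holonomyHom (ZerothHomotopy.mk γ)) = ZerothHomotopy.mk γ
    rw [h1, holonomyHom_wordEval, loopHom_wordEval]
  right_inv g := by
    obtain ⟨w, rfl⟩ := wordEval_gen_surjective g
    rw [loopHom_wordEval, holonomyHom_wordEval]
  map_mul' := map_mul holonomyHom

end Iso

/-! ### Words represent the topological fundamental group -/

section Quotient

variable {X : Type u} [TopologicalSpace X]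

/-- The concatenation of the loops `u_x` and their reverses along a word. -/
noncomputable def wordLoop : (n : ℕ) → (Fin n → X ⊕ X) → Path (Susp.base X) (Susp.base X)
  | 0, _ => Path.refl _
  | n + 1, w => (Sum.elim Susp.loop (fun x => (Susp.loop x).symm) (w 0)).trans
      (wordLoop n fun i => w i.succ)

theorem continuous_wordLoop (n : ℕ) : Continuous (wordLoop n : (Fin n → X ⊕ X) → _) := by
  induction n with
  | zero => exact continuous_const
  | succ n ih =>
    have h : Continuous (Sum.elim Susp.loop (fun x => (Susp.loop x).symm) :
        X ⊕ X → Path (Susp.base X) (Susp.base X)) :=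
      continuous_sum_dom.mpr ⟨continuous_loop, Path.continuous_symm.comp continuous_loop⟩
    exact Path.continuous_trans.comp ((h.comp (continuous_apply 0)).prodMk
      (ih.comp (continuous_pi fun i => continuous_apply i.succ)))

theorem mk_wordLoop (n : ℕ) (w : Fin n → X ⊕ X) :
    (ZerothHomotopy.mk (wordLoop n w) : PiOneTop (Susp X) (Susp.base X)) =
      wordEval loopClass ⟨n, w⟩ := by
  induction n with
  | zero => rfl
  | succ n ih =>
    rw [wordLoop, ← PiOneTop.mk_mul_mk, ih, wordEval, wordEval, List.ofFn_succ, List.prod_cons]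
    congr 1
    change _ = Sum.elim loopClass (fun x => (loopClass x)⁻¹) (w 0)
    rcases w 0 with x | x <;> rfl

/-- The topology of `π₁ᵗᵒᵖ(Σ(X₊))` is the quotient topology with respect to words in `X`. -/
theorem isQuotientMap_wordEval_loopClass : IsQuotientMap
    (wordEval loopClass : Words X → PiOneTop (Susp X) (Susp.base X)) := by
  have hc : Continuous (wordEval loopClass : Words X → PiOneTop (Susp X) (Susp.base X)) := by
    refine continuous_sigma fun n => ?_
    simp only [← mk_wordLoop]
    exact ZerothHomotopy.isQuotientMap_mk.continuous.comp (continuous_wordLoop n)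
  refine ⟨isCoinducing_iff.mpr fun V => ⟨fun hV => ?_, fun hV => hV.preimage hc⟩, ?_⟩
  · -- A loop `α` in the preimage of `V` has a neighbourhood on which `w` lifts loops to words.
    refine ZerothHomotopy.isQuotientMap_mk.isOpen_preimage.mp (isOpen_iff_mem_nhds.mpr ?_)
    intro α hα
    obtain ⟨N, w, hN, hαN, hw, h⟩ := exists_local_word α
    have hm : N ∩ w ⁻¹' (wordEval loopClass ⁻¹' V) ∈ 𝓝 α := by
      refine (hw.isOpen_inter_preimage hN hV).mem_nhds ⟨hαN, ?_⟩
      change wordEval loopClass (w α) ∈ V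
      rw [← (h α hαN).1]
      exact hα
    filter_upwards [hm] with β hβ
    change ZerothHomotopy.mk β ∈ V
    rw [(h β hβ.1).1]
    exact hβ.2
  · rintro ⟨γ⟩
    obtain ⟨N, w, -, hγ, -, h⟩ := exists_local_word γ
    exact ⟨w γ, (h γ hγ).1.symm⟩

/-- The canonical isomorphism is a homeomorphism precisely when the free group carries the quotient
topology with respect to words in `X`. -/
theorem canonicalIso_iff : CanonicalIso X ↔
    IsQuotientMap (wordEval gen : Words X → FR (ZerothHomotopy X)) := by
  have hcomp : (wordEval gen : Words X → FR (ZerothHomotopy X)) =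
      holonomyEquiv ∘ wordEval loopClass := by
    funext w
    exact (holonomyHom_wordEval w).symm
  constructor
  · rintro ⟨e, he⟩
    have h : (wordEval gen : Words X → FR (ZerothHomotopy X)) = e ∘ wordEval loopClass := by
      funext w
      refine (Eq.trans (map_wordEval (e : _ →* FR (ZerothHomotopy X)) loopClass w) ?_).symm
      congr 1
      funext x
      exact he x
    rw [h]
    exact e.toHomeomorph.isQuotientMap.comp isQuotientMap_wordEval_loopClass
  · intro h
    have hq : IsQuotientMap (holonomyEquiv (X := X)) :=
      IsQuotientMap.of_comp_isQuotientMap isQuotientMap_wordEval_loopClass (hcomp ▸ h)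
    have hs : Continuous (holonomyEquiv (X := X)).symm := by
      refine hq.continuous_iff.mpr ?_
      convert continuous_id
      funext g
      exact holonomyEquiv.symm_apply_apply g
    exact ⟨⟨holonomyEquiv, hq.continuous, hs⟩, holonomyHom_loopClass⟩

end Quotient

end TopFund

namespace TopFund

open Set

/-! ### Quotient maps of words -/

/-- The word with the given signs and underlying points; `true` marks a positive letter. -/
def signed {Z : Type*} {n : ℕ} (ε : Fin n → Bool) (z : Fin n → Z) : Fin n → Z ⊕ Z :=
  fun i => if ε i then Sum.inl (z i) else Sum.inr (z i)

theorem isOpenEmbedding_signed {Z : Type*} [TopologicalSpace Z] {n : ℕ} (ε : Fin n → Bool) :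
    IsOpenEmbedding (signed ε : (Fin n → Z) → Fin n → Z ⊕ Z) := by
  refine IsOpenEmbedding.piMap (f := fun i z => if ε i then Sum.inl z else Sum.inr z) fun i => ?_
  by_cases h : ε i
  · simpa [h] using IsOpenEmbedding.inl
  · simpa [h] using IsOpenEmbedding.inr

theorem signed_isLeft {Z : Type*} {n : ℕ} (w : Fin n → Z ⊕ Z) :
    signed (fun i => (w i).isLeft) (fun i => (w i).elim id id) = w := by
  funext i
  rcases h : w i with z | z <;> simp [signed, h]

/-- If the powers of `q` are quotient maps, then so is the map it induces on words, because the
words with prescribed length and signs form an open copy of a power. -/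
theorem isQuotientMap_map {X Y : Type*} [TopologicalSpace X] [TopologicalSpace Y] {q : X → Y}
    (hq : ∀ n : ℕ, 1 ≤ n → IsQuotientMap fun (x : Fin n → X) i => q (x i)) (hc : Continuous q)
    (hs : Function.Surjective q) : IsQuotientMap (Words.map q) := by
  refine ⟨isCoinducing_iff.mpr fun V =>
    ⟨fun hV => ?_, fun hV => hV.preimage (Words.continuous_map hc)⟩, ?_⟩
  · rw [isOpen_sigma_iff] at hV ⊢
    intro n
    rcases Nat.eq_zero_or_pos n with rfl | hn
    · -- There is only one word of length `0`.
      exact isOpen_discrete _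
    refine isOpen_iff_mem_nhds.mpr fun w hw => ?_
    -- The words with the same signs as `w` form an open copy of a power of `Y`.
    set ε : Fin n → Bool := fun i => (w i).isLeft
    have ho : IsOpen (signed ε ⁻¹' (Sigma.mk (β := fun m => Fin m → Y ⊕ Y) n ⁻¹' V)) := by
      refine (hq n hn).isOpen_preimage.mp ?_
      convert (hV n).preimage (isOpenEmbedding_signed ε).continuous using 1
      ext x
      have : (⟨n, signed ε fun i => q (x i)⟩ : Words Y) = Words.map q ⟨n, signed ε x⟩ := by
        simp only [Words.map]
        congr
        funext i
        simp only [signed]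
        split_ifs <;> rfl
      simp only [mem_preimage, this]
    refine Filter.mem_of_superset (((isOpenEmbedding_signed ε).isOpenMap _ ho).mem_nhds
      ⟨fun i => (w i).elim id id, ?_, signed_isLeft w⟩) (image_preimage_subset _ _)
    rw [mem_preimage, signed_isLeft]
    exact hw
  · rintro ⟨n, v⟩
    choose r hr using hs
    refine ⟨⟨n, fun i => Sum.map r r (v i)⟩, ?_⟩
    simp only [Words.map, Sum.map_map]
    congr
    funext i
    rcases v i with y | y <;> simp [hr]

/-! ### Words that reduce to a given positive word -/

/-- The map `Fin (m - 2) → Fin m` that skips `i` and `i + 1`. -/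
def skip {m : ℕ} (i : ℕ) (j : Fin (m - 2)) : Fin m :=
  ⟨if (j : ℕ) < i then j else j + 2, by split_ifs <;> omega⟩

theorem ofFn_skip {α : Type*} {m : ℕ} (v : Fin m → α) {i : ℕ} (hi : i + 1 < m) :
    List.ofFn (fun j => v (skip i j)) = (List.ofFn v).take i ++ (List.ofFn v).drop (i + 2) := by
  apply List.ext_getElem
  · simp; omega
  · intro j h1 h2
    have hm : min i m = i := by omega
    simp only [List.getElem_ofFn, List.getElem_append, List.length_take, List.length_ofFn,
      List.getElem_take, List.getElem_drop, skip, hm]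
    by_cases hj : j < i
    · simp only [hj, if_true, dif_pos]
    · simp only [hj, if_false, dif_neg, not_false_eq_true]
      congr 2; omega

/-- Deleting two adjacent inverse letters does not change the reduction of a word. -/
theorem reduction_skip {Y : Type*} {m : ℕ} (v : Fin m → Y ⊕ Y) {i : ℕ} (hi : i + 1 < m)
    (h : v ⟨i, by omega⟩ = (v ⟨i + 1, hi⟩).swap) :
    FR.reduction ⟨m - 2, fun j => v (skip i j)⟩ = FR.reduction ⟨m, v⟩ := by
  simp only [FR.reduction]
  rw [ofFn_skip (fun j => FR.letter (v j)) hi, List.prod_append]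
  conv_rhs => rw [← List.take_append_drop i (List.ofFn fun j => FR.letter (v j)), List.prod_append]
  congr 1
  rw [List.drop_eq_getElem_cons (i := i) (by simp; omega),
    List.drop_eq_getElem_cons (i := i + 1) (by simpa using hi)]
  simp only [List.getElem_ofFn, List.prod_cons, h, FR.letter_swap, inv_mul_cancel_left]

/-- A letter as an entry of a list representing an element of the free group. -/
def pair {Y : Type*} : Y ⊕ Y → Y × Bool := Sum.elim (fun y => (y, true)) fun y => (y, false)

theorem pair_injective {Y : Type*} : Function.Injective (pair (Y := Y)) := by
  rintro (a | a) (b | b) h <;> simp_all [pair]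

theorem reduction_eq_mk {Y : Type*} {m : ℕ} (v : Fin m → Y ⊕ Y) :
    FR.reduction ⟨m, v⟩ = (FreeGroup.mk (List.ofFn fun i => pair (v i)) : FreeGroup Y) := by
  have h := wordEval_eq_lift FreeGroup.of ⟨m, v⟩
  induction m with
  | zero => rfl
  | succ m ih =>
    have e : FR.reduction ⟨m + 1, v⟩ =
        FR.letter (v 0) * FR.reduction ⟨m, fun i => v i.succ⟩ := by
      simp [FR.reduction, List.ofFn_succ]
    rw [e, ih, List.ofFn_succ, ← List.singleton_append, ← FreeGroup.mul_mk]
    · congr 1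
      rcases v 0 with y | y <;> rfl
    · exact wordEval_eq_lift _ _

/-- A word reduces to a given positive word if and only if it is that word, or it contains a
cancelling pair of adjacent letters whose deletion leaves a word that reduces to it. -/
theorem reduction_eq_positive_iff {Y : Type*} {m n : ℕ} (v : Fin m → Y ⊕ Y) (c : Fin n → Y) :
    FR.reduction ⟨m, v⟩ = FR.reduction ⟨n, fun i => Sum.inl (c i)⟩ ↔
      (⟨m, v⟩ : Words Y) = ⟨n, fun i => Sum.inl (c i)⟩ ∨
      ∃ (i : ℕ) (hi : i + 1 < m), v ⟨i, by omega⟩ = (v ⟨i + 1, hi⟩).swap ∧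
        FR.reduction ⟨m - 2, fun j => v (skip i j)⟩ =
          FR.reduction ⟨n, fun i => Sum.inl (c i)⟩ := by
  classical
  constructor
  · intro h
    by_cases hr : FreeGroup.IsReduced (List.ofFn fun i => pair (v i))
    · left
      have hp : FreeGroup.IsReduced (List.ofFn fun i => pair (Sum.inl (c i) : Y ⊕ Y)) := by
        rw [FreeGroup.IsReduced, List.isChain_iff_getElem]
        intro i hi
        simp [pair]
      rw [reduction_eq_mk, reduction_eq_mk] at h
      have h' := FreeGroup.reduce.sound h
      rw [FreeGroup.isReduced_iff_reduce_eq.mp hr, FreeGroup.isReduced_iff_reduce_eq.mp hp,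
        List.ofFn_inj'] at h'
      obtain rfl : m = n := congrArg Sigma.fst h'
      congr 1
      funext i
      exact pair_injective (congrFun (eq_of_heq (Sigma.mk.inj h').2) i)
    · right
      rw [FreeGroup.IsReduced, List.isChain_iff_getElem] at hr
      push Not at hr
      obtain ⟨i, hi, h1, h2⟩ := hr
      have hi' : i + 1 < m := by simpa using hi
      simp only [List.getElem_ofFn] at h1 h2
      have hs : v ⟨i, by omega⟩ = (v ⟨i + 1, hi'⟩).swap := by
        rcases ha : v ⟨i, by omega⟩ with a | a <;> rcases hb : v ⟨i + 1, hi'⟩ with b | b <;>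
          simp_all [pair]
      exact ⟨i, hi', hs, (reduction_skip v hi' hs).trans h⟩
  · rintro (h | ⟨i, hi, hs, h⟩)
    · rw [h]
    · rw [← h, reduction_skip v hi hs]

/-- If `C` is a set of positive words over `Y` whose preimage in `Xⁿ` is closed, then the words in
`X` whose images reduce to an element of `C` form a closed set: cancellation of two letters is a closed
condition since `Y` is Hausdorff. -/
theorem isClosed_reduction_mem {X Y : Type*} [TopologicalSpace X] [TopologicalSpace Y] [T2Space Y]
    {q : X → Y} (hq : Continuous q) {n : ℕ} {C : Set (Fin n → Y)}
    (hC : IsClosed {x : Fin n → X | (fun i => q (x i)) ∈ C}) (m : ℕ) :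
    IsClosed {w : Fin m → X ⊕ X | ∃ c ∈ C, FR.reduction (Words.map q ⟨m, w⟩) =
      FR.reduction ⟨n, fun i => Sum.inl (c i)⟩} := by
  induction m using Nat.strong_induction_on with
  | _ m ih =>
  have hset : {w : Fin m → X ⊕ X | ∃ c ∈ C, FR.reduction (Words.map q ⟨m, w⟩) =
      FR.reduction ⟨n, fun i => Sum.inl (c i)⟩} =
      {w | ∃ c ∈ C, Words.map q ⟨m, w⟩ = ⟨n, fun i => Sum.inl (c i)⟩} ∪
      ⋃ (i : Fin m) (hi : (i : ℕ) + 1 < m),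
        {w | Sum.map q q (w i) = (Sum.map q q (w ⟨i + 1, hi⟩)).swap} ∩
        (fun w j => w (skip i j)) ⁻¹' {w : Fin (m - 2) → X ⊕ X | ∃ c ∈ C,
          FR.reduction (Words.map q ⟨m - 2, w⟩) = FR.reduction ⟨n, fun i => Sum.inl (c i)⟩} := by
    ext w
    simp only [Words.map, reduction_eq_positive_iff (fun i => Sum.map q q (w i)), mem_ofPred_eq,
      mem_union, mem_iUnion, mem_inter_iff, mem_preimage]
    constructor
    · rintro ⟨c, hc, h | ⟨i, hi, hs, h⟩⟩
      · exact Or.inl ⟨c, hc, h⟩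
      · exact Or.inr ⟨⟨i, by omega⟩, hi, hs, c, hc, h⟩
    · rintro (⟨c, hc, h⟩ | ⟨i, hi, hs, c, hc, h⟩)
      · exact ⟨c, hc, Or.inl h⟩
      · exact ⟨c, hc, Or.inr ⟨i, hi, hs, h⟩⟩
  rw [hset]
  refine IsClosed.union ?_ (isClosed_iUnion_of_finite fun i => isClosed_iUnion_of_finite fun hi =>
    IsClosed.inter (isClosed_eq ?_ ?_) ((ih (m - 2) (by omega)).preimage ?_))
  · by_cases hmn : m = n
    · subst hmn
      have hfold : Continuous fun (w : Fin m → X ⊕ X) i => (w i).elim id id :=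
        continuous_pi fun i => (continuous_sum_dom.mpr ⟨continuous_id, continuous_id⟩ :
          Continuous (Sum.elim id id : X ⊕ X → X)).comp (continuous_apply i)
      have hleft : Continuous fun (w : Fin m → X ⊕ X) i => (w i).isLeft :=
        continuous_pi fun i => (continuous_sum_dom.mpr ⟨continuous_const, continuous_const⟩ :
          Continuous (Sum.isLeft : X ⊕ X → Bool)).comp (continuous_apply i)
      convert (isClosed_eq hleft (continuous_const (y := fun _ => true))).inter
        (hC.preimage hfold) using 1
      ext w
      simp only [Words.map, mem_ofPred_eq, mem_inter_iff, mem_preimage, funext_iff, Sigma.mk.injEq,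
        heq_eq_eq, true_and]
      constructor
      · rintro ⟨c, hc, h⟩
        have : (fun i => q ((w i).elim id id)) = c := by
          funext i
          have := h i
          rcases hw : w i with a | a <;> simp_all
        refine ⟨fun i => ?_, this ▸ hc⟩
        have := h i
        rcases hw : w i with a | a <;> simp_all
      · rintro ⟨h1, h2⟩
        refine ⟨_, h2, fun i => ?_⟩
        have := h1 i
        rcases hw : w i with a | a <;> simp_all
    · convert isClosed_empty
      refine eq_empty_of_forall_notMem fun w => ?_
      rintro ⟨c, -, h⟩
      exact hmn (congrArg Sigma.fst h)
  · exact (hq.sumMap hq).comp (continuous_apply _)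
  · exact continuous_sum_swap.comp ((hq.sumMap hq).comp (continuous_apply _))
  · exact continuous_pi fun j => continuous_apply _

theorem reduction_positive_injective {Y : Type*} {n : ℕ} {c d : Fin n → Y}
    (h : FR.reduction ⟨n, fun i => Sum.inl (c i)⟩ = FR.reduction ⟨n, fun i => Sum.inl (d i)⟩) :
    c = d := by
  rcases (reduction_eq_positive_iff _ _).mp h with h | ⟨i, hi, hs, -⟩
  · funext i
    have := congrFun (eq_of_heq (Sigma.mk.inj h).2) i
    exact Sum.inl_injective this
  · cases hs

/-- If the free group on a Hausdorff space `Y` carries the quotient topology with respect to words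
in `X`, then the powers of `X → Y` are quotient maps: a subset of `Yⁿ` with closed preimage is
recovered from its closed image in the free group. -/
theorem isQuotientMap_pow {X Y : Type*} [TopologicalSpace X] [TopologicalSpace Y] [T2Space Y]
    {q : X → Y} (hc : Continuous q) (hs : Function.Surjective q)
    (h : IsQuotientMap fun w : Words X => FR.reduction (w.map q)) (n : ℕ) :
    IsQuotientMap fun (x : Fin n → X) i => q (x i) := by
  have hpow : Continuous fun (x : Fin n → X) i => q (x i) := by fun_prop
  refine isQuotientMap_iff_isClosed.mpr ⟨hs.comp_left, fun C =>
    ⟨fun hC => hC.preimage hpow, fun hC => ?_⟩⟩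
  have hcl : IsClosed ((fun c : Fin n → Y => FR.reduction ⟨n, fun i => Sum.inl (c i)⟩) '' C) := by
    refine h.isClosed_preimage.mp (isClosed_sigma_iff.mpr fun m => ?_)
    convert isClosed_reduction_mem hc hC m using 1
    ext w
    simp only [mem_preimage, mem_image, mem_ofPred_eq, eq_comm]
  have hpos : Continuous fun c : Fin n → Y => FR.reduction ⟨n, fun i => Sum.inl (c i)⟩ :=
    FR.isQuotientMap_reduction.continuous.comp
      ((continuous_sigmaMk (σ := fun m => Fin m → Y ⊕ Y) (i := n)).comp
        (continuous_pi fun i => continuous_inl.comp (continuous_apply i)))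
  convert hcl.preimage hpos using 1
  exact (preimage_image_eq C fun c d => reduction_positive_injective).symm

end TopFund

theorem mainTheorem8 (X : Type*) [TopologicalSpace X] [T2Space X] :
    ((∀ n : ℕ, 1 ≤ n → Topology.IsQuotientMap (TopFund.powP X n)) → TopFund.CanonicalIso X) ∧
    (T2Space (ZerothHomotopy X) →
      (TopFund.CanonicalIso X ↔ ∀ n : ℕ, 1 ≤ n → Topology.IsQuotientMap (TopFund.powP X n))) := by
  have hP : IsQuotientMap (ZerothHomotopy.mk : X → ZerothHomotopy X) :=
    ZerothHomotopy.isQuotientMap_mk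
  have key : (∀ n : ℕ, 1 ≤ n → IsQuotientMap (TopFund.powP X n)) → TopFund.CanonicalIso X := by
    intro h
    rw [TopFund.canonicalIso_iff, funext TopFund.wordEval_gen]
    exact TopFund.FR.isQuotientMap_reduction.comp
      (TopFund.isQuotientMap_map h hP.continuous hP.surjective)
  refine ⟨key, fun _ => ⟨fun h n _ => ?_, key⟩⟩
  rw [TopFund.canonicalIso_iff, funext TopFund.wordEval_gen] at h
  exact TopFund.isQuotientMap_pow hP.continuous hP.surjective h n
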